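/- **Setting.** Let $d\ge 0$ and let $U:\mathbb R^d\to\mathbb R$ be $C^3$ with a global minimum at $0$, $U(0)=0$, $L:=\sup_x\|D^2U(x)\|<\infty$ and $L_H:=\sup_x\|D^3U(x)\|<\infty$ (operator norms of multilinear forms for the Euclidean norm). Let $T,h>0$ satisfy $N:=T/h\in\mathbb N$ and $L(T^2+Th)\le 1/6$. One velocity Verlet step maps $(q,v)$ to $(q',v')$ with $$q'=q+hv-\tfrac{h^2}{2}\nabla U(q),\qquad v'=v-\tfrac h2\big(\nabla U(q)+\nabla U(q')\big).$$ Let $\tilde q_T(x,v)$ be the position after $N$ such steps from $(x,v)$. The unadjusted Hamiltonian Monte Carlo (uHMC) transition kernel is $\tilde\pi(x,A)=P[\tilde q_T(x,\xi)\in A]$ with $\xi\sim\mathcal N(0,I_d)$. Let $W^1(\nu,\eta)\in[0,\infty]$ be the $L^1$-Wasserstein distance for the Euclidean metric and $\mathrm{TV}(\nu,\eta)=\sup_A|\nu(A)-\eta(A)|$, the supremum over Borel sets. Assume that $\tilde\mu$ is an invariant probability measure of $\tilde\pi$ and that $M_1,c\in(0,\infty)$ are such that $$W^1(\nu\tilde\pi^m,\tilde\mu)\le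 M_1e^{-cm}\,W^1(\nu,\tilde\mu)\qquad\text{for all integers } m\ge1\text{ and all probability measures }\nu\text{ on }\mathbb R^d.$$ Put $t_{\mathrm{mix}}(\varepsilon,\nu)=\inf\{m\ge0:\mathrm{TV}(\tilde\mu,\nu\tilde\pi^m)\le\varepsilon\}$, with $\inf\emptyset=\infty$. **(1) Mixing time bound.** For every $\varepsilon>0$ and every probability measure $\nu$ on $\mathbb R^d$, $$t_{\mathrm{mix}}(\varepsilon,\nu)\ \le\ \max\left\{1,\ 2+\frac1c\log\left(\frac{3\,(T^{-2}+27\,d\,L_H^2T^4)^{1/2}\,M_1\,W^1(\tilde\mu,\nu)}{2\varepsilon}\right)\right\},$$ where $\log 0=-\infty$ and $\log\infty=\infty$. **(2) Logarithmic dependence on the dimension.** For all $T,c,A\in\mathbb R$ and $p\in\mathbb N_0$ there is a constant $C\in\mathbb R$ depending only on $T,c,A,p$ such that, for every $d\ge1$ and all $U,h,\tilde\mu,M_1$ satisfying the assumptions above in dimension $d$ with these $T$ and $c$, and with $L_H\le A d^p$ and $M_1\le A d^p$, and for every probability measure $\nu$ with $W^1(\tilde\mu,\nu)\le A d^p$ and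 every $\varepsilon\in(0,1)$, $$t_{\mathrm{mix}}(\varepsilon,\nu)\ \le\ C\,\big(1+\log d+\log(1/\varepsilon)\big).$$ -/

import Mathlib

open MeasureTheory ProbabilityTheory
open scoped ENNReal

noncomputable section

namespace UHMC

/-- Euclidean space of dimension `d`. -/
abbrev E (d : ℕ) : Type := EuclideanSpace ℝ (Fin d)

/-! ### Distances between probability measures -/

/-- Total variation distance: the supremum of `|ν A - η A|` over Borel sets `A`. -/
def tv {d : ℕ} (ν η : Measure (E d)) : ℝ :=
  ⨆ A : {A : Set (E d) // MeasurableSet A}, |ν.real A.1 - η.real A.1|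

/-- `γ` is a coupling of `ν` and `η`. -/
def IsCoupling {d : ℕ} (γ : Measure (E d × E d)) (ν η : Measure (E d)) : Prop :=
  γ.map Prod.fst = ν ∧ γ.map Prod.snd = η

/-- `L¹`-Wasserstein distance for the Euclidean metric, with values in `[0, ∞]`. -/
def W1 {d : ℕ} (ν η : Measure (E d)) : ℝ≥0∞ :=
  ⨅ (γ : Measure (E d × E d)) (_ : IsCoupling γ ν η), ∫⁻ p, edist p.1 p.2 ∂γ

/-! ### The velocity Verlet integrator and the uHMC transition kernel -/

/-- One step of velocity Verlet with step size `h`, acting on (position, velocity). -/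
def verletStep {d : ℕ} (U : E d → ℝ) (h : ℝ) (z : E d × E d) : E d × E d :=
  let q := z.1 + h • z.2 - (h ^ 2 / 2) • gradient U z.1
  (q, z.2 - (h / 2) • (gradient U z.1 + gradient U q))

/-- Position after `N` velocity Verlet steps of size `h`, started at `(x, v)`. -/
def verletPosition {d : ℕ} (U : E d → ℝ) (h : ℝ) (N : ℕ) (x v : E d) : E d :=
  ((verletStep U h)^[N] (x, v)).1

lemma measurable_gradient {d : ℕ} (U : E d → ℝ) : Measurable (gradient U) := by
  unfold gradient
  exact (InnerProductSpace.toDual ℝ (E d)).symm.continuous.measurable.comp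
    (measurable_fderiv ℝ U)

lemma measurable_verletStep {d : ℕ} (U : E d → ℝ) (h : ℝ) :
    Measurable (verletStep U h) := by
  have hg := measurable_gradient U
  have hq : Measurable
      fun z : E d × E d => z.1 + h • z.2 - (h ^ 2 / 2) • gradient U z.1 := by
    fun_prop
  have hgq := hg.comp hq
  exact hq.prodMk (measurable_snd.sub
    (((hg.comp measurable_fst).add hgq).const_smul (h / 2)))

lemma measurable_verletPosition {d : ℕ} (U : E d → ℝ) (h : ℝ) (N : ℕ) :
    Measurable fun p : E d × E d => verletPosition U h N p.1 p.2 :=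
  measurable_fst.comp ((measurable_verletStep U h).iterate N)

/-- Transition kernel of uHMC with step size `h` and duration `N * h`: the kernel at `x` is the law
of the Verlet position started at `(x, ξ)`, where `ξ` is standard Gaussian. -/
def kernel {d : ℕ} (U : E d → ℝ) (h : ℝ) (N : ℕ) : Kernel (E d) (E d) where
  toFun x := (stdGaussian (E d)).map (verletPosition U h N x)
  measurable' := by
    refine Measure.measurable_of_measurable_coe _ fun A hA => ?_
    have hm := measurable_verletPosition U h N
    have h1 : ∀ x, ((stdGaussian (E d)).map (verletPosition U h N x)) A =
        stdGaussian (E d)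
          (Prod.mk x ⁻¹' ((fun p : E d × E d => verletPosition U h N p.1 p.2) ⁻¹' A)) := by
      intro x
      have hx : Measurable (verletPosition U h N x) := hm.comp measurable_prodMk_left
      rw [Measure.map_apply hx hA]
      rfl
    simp_rw [h1]
    exact measurable_measure_prodMk_left (hm hA)

/-- The law `ν π̃ᵐ` of the uHMC chain after `m` transitions, started from the law `ν`. -/
def law {d : ℕ} (U : E d → ℝ) (h : ℝ) (N : ℕ) (ν : Measure (E d)) (m : ℕ) : Measure (E d) :=
  (fun η => η.bind (kernel U h N))^[m] ν

/-- The `ε`-mixing time `inf {m ≥ 0 : TV(μt, ν π̃ᵐ) ≤ ε}`, equal to `⊤` if there is no such `m`. -/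
def mixingTime {d : ℕ} (U : E d → ℝ) (h : ℝ) (N : ℕ) (μt : Measure (E d)) (ε : ℝ)
    (ν : Measure (E d)) : ℕ∞ :=
  ⨅ (m : ℕ) (_ : tv μt (law U h N ν m) ≤ ε), (m : ℕ∞)

/-! ### Assumptions -/

/-- `L = sup ‖D²U‖`, in the operator norm of bilinear forms. -/
def L {d : ℕ} (U : E d → ℝ) : ℝ := ⨆ x, ‖iteratedFDeriv ℝ 2 U x‖

/-- `L_H = sup ‖D³U‖`, in the operator norm of trilinear forms. -/
def LH {d : ℕ} (U : E d → ℝ) : ℝ := ⨆ x, ‖iteratedFDeriv ℝ 3 U x‖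

/-- `U` is `C³`, has a global minimum at `0` with `U 0 = 0`, and has bounded second and third
derivatives. -/
structure Potential {d : ℕ} (U : E d → ℝ) : Prop where
  zero : U 0 = 0
  min : ∀ x, U 0 ≤ U x
  smooth : ContDiff ℝ 3 U
  bdd_two : BddAbove (Set.range fun x => ‖iteratedFDeriv ℝ 2 U x‖)
  bdd_three : BddAbove (Set.range fun x => ‖iteratedFDeriv ℝ 3 U x‖)

/-- `T > 0`, `h > 0`, `T / h = N` is an integer, and `L (T² + T h) ≤ 1/6`. -/
structure StepSize {d : ℕ} (U : E d → ℝ) (T h : ℝ) (N : ℕ) : Prop where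
  T_pos : 0 < T
  h_pos : 0 < h
  div : T / h = N
  bound : L U * (T ^ 2 + T * h) ≤ 1 / 6

/-- `μt` is an invariant probability measure of the uHMC kernel, and the chain converges to it
geometrically in `W¹`, with constants `M₁, c ∈ (0, ∞)`, from every initial law. -/
structure W1Convergence {d : ℕ} (U : E d → ℝ) (h : ℝ) (N : ℕ) (μt : Measure (E d))
    (M₁ c : ℝ) : Prop where
  prob : IsProbabilityMeasure μt
  invariant : Kernel.Invariant (kernel U h N) μt
  M₁_pos : 0 < M₁
  c_pos : 0 < c
  conv : ∀ m : ℕ, 1 ≤ m → ∀ ν : Measure (E d), IsProbabilityMeasure ν →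
    W1 (law U h N ν m) μt ≤ ENNReal.ofReal (M₁ * Real.exp (-c * m)) * W1 ν μt

end UHMC

end

/-! A single uHMC transition turns Wasserstein closeness into total variation closeness, with factor
`S = √(T⁻² + 27 d L_H² T⁴)`. Hence `m ≥ 1` contracting transitions followed by one regularizing
transition give total variation at most `S M₁ exp(-c m) W1`, and it remains to choose `m`.

Regularization (`abs_stdGaussian_preimage_sub_le`): because `L T² ≤ 1/6`, the map from velocity to
final position is a small perturbation of the free flight `v ↦ y + T v`, with bijectivity and
invertible derivative. For given `x, y`, let `Ψ` replace `v` by the velocity that leads from `y` to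
the point reached from `(x, v)`. The transition laws from `x` and `y` are then at most as far apart
as the Gaussian and its image under `Ψ = id + g`, where `g` is of order `|x - y| / T` and `Dg` of
order `L_H T² |x - y|`.

That distance is bounded by the root of a relative entropy (`abs_stdGaussian_sub_preimage_le`). The
first-order term `⟨v, g⟩ - tr Dg` has Gaussian mean zero by integration by parts. What is left is
quadratic, and the dimension enters only through the `d` eigenvalues in the determinant of `id +
Dg`. Testing couplings against the Lipschitz functions `x ↦ π̃(x, A)` extends the estimate to
arbitrary initial laws.

The convergence assumption is silent at `m = 0`. That case needs `M₁` bounded below (`le_M₁`), and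
the factor `3/2` in the theorem leaves room for this. Part (2) holds because the argument of the
logarithm is polynomial in `d`. -/

noncomputable section

namespace UHMC

/-! ### A discrete Gronwall estimate for the leapfrog recursion -/

/-- `a` and `b` are the position and velocity components of a leapfrog recursion with forces `F`. -/
structure Leapfrog {V : Type*} [NormedAddCommGroup V] [NormedSpace ℝ V] (h : ℝ) (a b F : ℕ → V) :
    Prop where
  pos : ∀ n, a (n + 1) = a n + h • b n - (h ^ 2 / 2) • F n
  vel : ∀ n, b (n + 1) = b n - (h / 2) • (F n + F (n + 1))

namespace Leapfrog

variable {V : Type*} [NormedAddCommGroup V] [NormedSpace ℝ V] {h : ℝ} {a b F : ℕ → V}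

/-- The half-step velocity `b n - (h/2) F n` moves the position exactly and changes by `-h F (n+1)`.
Its deviations `h (k + 1/2) B`, summed over `k < n` with weight `h`, give `h² n² B / 2`, the
continuous-time value. The guard `n < N` is there because `F n` is controlled only then. -/
lemma norm_sub_le (hl : Leapfrog h a b F) (hh : 0 ≤ h) {B : ℝ} {N : ℕ}
    (hF : ∀ k < N, ‖F k‖ ≤ B) :
    ∀ n ≤ N, ‖a n - a 0 - (n * h : ℝ) • b 0‖ ≤ h ^ 2 * n ^ 2 / 2 * B ∧
      (n < N → ‖b n - (h / 2) • F n - b 0‖ ≤ h * (n + 1 / 2) * B) := by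
  intro n
  induction n with
  | zero =>
    intro _
    refine ⟨by simp, fun h0 => ?_⟩
    have e : b 0 - (h / 2) • F 0 - b 0 = -((h / 2) • F 0) := by abel
    rw [e, norm_neg, norm_smul, Real.norm_of_nonneg (by positivity)]
    have := mul_le_mul_of_nonneg_left (hF 0 h0) (by positivity : 0 ≤ h / 2)
    push_cast; linarith
  | succ n ih =>
    intro hn
    obtain ⟨i1, i2⟩ := ih (by omega)
    have i2 := i2 (by omega)
    constructor
    · have e : a (n + 1) - a 0 - ((n + 1 : ℕ) * h : ℝ) • b 0 =
          (a n - a 0 - (n * h : ℝ) • b 0) + h • (b n - (h / 2) • F n - b 0) := by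
        rw [hl.pos]; push_cast; module
      rw [e]
      refine (norm_add_le _ _).trans ?_
      rw [norm_smul, Real.norm_of_nonneg hh]
      have := mul_le_mul_of_nonneg_left i2 hh
      push_cast; linarith
    · intro hn'
      have e : b (n + 1) - (h / 2) • F (n + 1) - b 0 =
          (b n - (h / 2) • F n - b 0) - h • F (n + 1) := by
        rw [hl.vel]; module
      rw [e]
      refine (_root_.norm_sub_le _ _).trans ?_
      rw [norm_smul, Real.norm_of_nonneg hh]
      have := mul_le_mul_of_nonneg_left (hF _ hn') hh
      push_cast; linarith

/-- Free flight at time `t` is a convex combination of its endpoints at times `0` and `T`.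
Controlling only the two endpoints lets one `D` serve different initial data. -/
lemma norm_add_smul_le {x y : V} {T t D : ℝ} (hT : 0 < T) (ht : 0 ≤ t) (htT : t ≤ T)
    (hx : ‖x‖ ≤ D) (hxy : ‖x + T • y‖ ≤ D) : ‖x + t • y‖ ≤ D := by
  have e : x + t • y = (1 - t / T) • x + (t / T) • (x + T • y) := by
    rw [smul_add, smul_smul, div_mul_cancel₀ _ hT.ne']; module
  have h0 : 0 ≤ t / T := by positivity
  have h1 : t / T ≤ 1 := (div_le_one hT).2 htT
  rw [e]
  refine (norm_add_le _ _).trans ?_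
  rw [norm_smul, norm_smul, Real.norm_of_nonneg h0, Real.norm_of_nonneg (by linarith)]
  nlinarith

/-- Growth of a leapfrog recursion with forces of linear growth over a short time. -/
lemma norm_le (hl : Leapfrog h a b F) {N : ℕ} {T ℓ β D : ℝ} (hh : 0 ≤ h) (hT : 0 < T)
    (hN : N * h = T) (hℓ : 0 ≤ ℓ) (hℓT : ℓ * T ^ 2 ≤ 1 / 6) (hβ : 0 ≤ β)
    (hF : ∀ k < N, ‖F k‖ ≤ ℓ * ‖a k‖ + β) (h0 : ‖a 0‖ ≤ D) (h1 : ‖a 0 + T • b 0‖ ≤ D) :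
    ∀ n ≤ N, ‖a n‖ ≤ 12 / 11 * (D + β * T ^ 2 / 2) := by
  intro n
  induction n using Nat.strong_induction_on with
  | _ n ih =>
    intro hn
    -- `M` solves `M = D + β T² / 2 + M / 12`, where `1/12` bounds `ℓ T² / 2`.
    set M := 12 / 11 * (D + β * T ^ 2 / 2) with hM
    have hD : 0 ≤ D := (norm_nonneg _).trans h0
    have hM0 : 0 ≤ M := by positivity
    have hb := ((hl.norm_sub_le hh (B := ℓ * M + β) (N := n) fun k hk =>
      (hF k (by omega)).trans (by gcongr; exact ih k hk (by omega))) n le_rfl).1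
    have hnT : (n : ℝ) * h ≤ T := by rw [← hN]; gcongr
    have hc := norm_add_smul_le hT (by positivity) hnT h0 h1
    have e : a n = (a n - a 0 - (n * h : ℝ) • b 0) + (a 0 + (n * h : ℝ) • b 0) := by abel
    rw [e]
    refine (norm_add_le _ _).trans ?_
    have h2 : h ^ 2 * n ^ 2 / 2 * (ℓ * M + β) ≤ T ^ 2 / 2 * (ℓ * M + β) := by
      gcongr; rw [← mul_pow, mul_comm h]; gcongr
    have h3 : ℓ * T ^ 2 * M ≤ 1 / 6 * M := by gcongr
    have h4 : T ^ 2 / 2 * (ℓ * M + β) = ℓ * T ^ 2 * M / 2 + β * T ^ 2 / 2 := by ring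
    linarith

lemma norm_sub_le_of_growth (hl : Leapfrog h a b F) {N : ℕ} {T ℓ D : ℝ} (hh : 0 ≤ h)
    (hT : 0 < T) (hN : N * h = T) (hℓ : 0 ≤ ℓ) (hℓT : ℓ * T ^ 2 ≤ 1 / 6)
    (hF : ∀ k < N, ‖F k‖ ≤ ℓ * ‖a k‖) (h0 : ‖a 0‖ ≤ D) (h1 : ‖a 0 + T • b 0‖ ≤ D) :
    ‖a N - a 0 - T • b 0‖ ≤ 1 / 11 * D := by
  have hD : 0 ≤ D := (norm_nonneg _).trans h0
  have hM := hl.norm_le hh hT hN hℓ hℓT le_rfl (by simpa using hF) h0 h1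
  have hb := ((hl.norm_sub_le hh (B := ℓ * (12 / 11 * D)) (N := N) fun k hk =>
    (hF k hk).trans (by gcongr; simpa using hM k hk.le)) N le_rfl).1
  rw [← mul_pow, mul_comm h, hN] at hb
  have : ℓ * T ^ 2 * D ≤ 1 / 6 * D := by gcongr
  linarith

end Leapfrog

/-! ### The gradient of the potential -/

/-- The Riesz isomorphism from the dual of a real Hilbert space, as a linear isometry. -/
def rieszSymm (d : ℕ) : StrongDual ℝ (E d) ≃ₗᵢ[ℝ] E d :=
  { (InnerProductSpace.toDual ℝ (E d)).symm with
    map_smul' := fun c x => by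
      simp }

lemma gradient_eq_rieszSymm_comp {d : ℕ} (U : E d → ℝ) :
    gradient U = rieszSymm d ∘ fderiv ℝ U := rfl

namespace Potential

variable {d : ℕ} {U : E d → ℝ}

lemma contDiff_gradient (hU : Potential U) : ContDiff ℝ 2 (gradient U) := by
  rw [gradient_eq_rieszSymm_comp]
  exact (rieszSymm d).contDiff.comp (hU.smooth.fderiv_right (by norm_num))

lemma differentiable_gradient (hU : Potential U) : Differentiable ℝ (gradient U) :=
  hU.contDiff_gradient.differentiable (by norm_num)

/-- The gradient is `fderiv ℝ U` followed by an isometry, so its derivatives have the norms of the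
multilinear forms that define `L` and `LH`. -/
lemma norm_fderiv_gradient_le (hU : Potential U) (x : E d) :
    ‖fderiv ℝ (gradient U) x‖ ≤ L U := by
  rw [← norm_iteratedFDeriv_one, gradient_eq_rieszSymm_comp,
    LinearIsometryEquiv.norm_iteratedFDeriv_comp_left, norm_iteratedFDeriv_fderiv]
  exact le_ciSup hU.bdd_two x

lemma norm_fderiv_fderiv_gradient_le (hU : Potential U) (x : E d) :
    ‖fderiv ℝ (fderiv ℝ (gradient U)) x‖ ≤ LH U := by
  rw [← norm_iteratedFDeriv_one, norm_iteratedFDeriv_fderiv, gradient_eq_rieszSymm_comp,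
    LinearIsometryEquiv.norm_iteratedFDeriv_comp_left, norm_iteratedFDeriv_fderiv]
  exact le_ciSup hU.bdd_three x

lemma L_nonneg (hU : Potential U) : 0 ≤ L U :=
  (norm_nonneg _).trans (hU.norm_fderiv_gradient_le 0)

lemma LH_nonneg (hU : Potential U) : 0 ≤ LH U :=
  (norm_nonneg (fderiv ℝ (fderiv ℝ (gradient U)) 0)).trans (hU.norm_fderiv_fderiv_gradient_le 0)

lemma norm_gradient_sub_le (hU : Potential U) (x y : E d) :
    ‖gradient U x - gradient U y‖ ≤ L U * ‖x - y‖ :=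
  convex_univ.norm_image_sub_le_of_norm_fderiv_le
    (fun z _ => hU.differentiable_gradient z) (fun z _ => hU.norm_fderiv_gradient_le z)
    (Set.mem_univ _) (Set.mem_univ _)

lemma norm_fderiv_gradient_sub_le (hU : Potential U) (x y : E d) :
    ‖fderiv ℝ (gradient U) x - fderiv ℝ (gradient U) y‖ ≤ LH U * ‖x - y‖ :=
  convex_univ.norm_image_sub_le_of_norm_fderiv_le
    (fun z _ => ((hU.contDiff_gradient.fderiv_right (m := 1) (by norm_num)).differentiable
      (by norm_num)) z) (fun z _ => hU.norm_fderiv_fderiv_gradient_le z)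
    (Set.mem_univ _) (Set.mem_univ _)

end Potential

/-! ### Verlet trajectories and their derivatives in the initial velocity -/

/-- Velocity after `n` velocity Verlet steps. -/
def verletVelocity {d : ℕ} (U : E d → ℝ) (h : ℝ) (n : ℕ) (x v : E d) : E d :=
  ((verletStep U h)^[n] (x, v)).2

section Trajectory

variable {d : ℕ} (U : E d → ℝ) (h : ℝ)

lemma verletPosition_succ (n : ℕ) (x v : E d) :
    verletPosition U h (n + 1) x v = verletPosition U h n x v + h • verletVelocity U h n x v -
      (h ^ 2 / 2) • gradient U (verletPosition U h n x v) := by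
  simp only [verletPosition, verletVelocity, Function.iterate_succ_apply']
  rfl

lemma verletVelocity_succ (n : ℕ) (x v : E d) :
    verletVelocity U h (n + 1) x v = verletVelocity U h n x v -
      (h / 2) • (gradient U (verletPosition U h n x v) +
        gradient U (verletPosition U h (n + 1) x v)) := by
  simp only [verletPosition, verletVelocity, Function.iterate_succ_apply']
  rfl

/-- The recursion is linear in position, velocity and force together. Differences of trajectories,
their velocity derivatives, and differences of those are all leapfrogs, and one Gronwall estimate
covers them. -/
lemma leapfrog_sub (x v y w : E d) :
    Leapfrog h (fun n => verletPosition U h n x v - verletPosition U h n y w)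
      (fun n => verletVelocity U h n x v - verletVelocity U h n y w)
      (fun n => gradient U (verletPosition U h n x v) -
        gradient U (verletPosition U h n y w)) where
  pos n := by simp only [verletPosition_succ]; module
  vel n := by simp only [verletVelocity_succ]; module

variable {U}

lemma differentiable_trajectory (hU : Potential U) (x : E d) (n : ℕ) :
    Differentiable ℝ (verletPosition U h n x) ∧ Differentiable ℝ (verletVelocity U h n x) := by
  have hg := hU.differentiable_gradient
  induction n with
  | zero =>
    exact ⟨differentiable_const x, differentiable_id⟩
  | succ n ih =>
    obtain ⟨i1, i2⟩ := ih
    have j1 : Differentiable ℝ (verletPosition U h (n + 1) x) := by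
      have : verletPosition U h (n + 1) x = _ := funext (verletPosition_succ U h n x)
      rw [this]
      exact (i1.fun_add (i2.fun_const_smul h)).fun_sub (Differentiable.fun_const_smul (hg.comp i1) _)
    refine ⟨j1, ?_⟩
    have : verletVelocity U h (n + 1) x = _ := funext (verletVelocity_succ U h n x)
    rw [this]
    exact i2.fun_sub (Differentiable.fun_const_smul
      (Differentiable.fun_add (hg.comp i1) (hg.comp j1)) _)

lemma differentiable_verletPosition (hU : Potential U) (x : E d) (n : ℕ) :
    Differentiable ℝ (verletPosition U h n x) :=
  (differentiable_trajectory h hU x n).1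

lemma leapfrog_fderiv (hU : Potential U) (x v : E d) :
    Leapfrog h (fun n => fderiv ℝ (verletPosition U h n x) v)
      (fun n => fderiv ℝ (verletVelocity U h n x) v)
      (fun n => (fderiv ℝ (gradient U) (verletPosition U h n x v)).comp
        (fderiv ℝ (verletPosition U h n x) v)) := by
  have hg (n : ℕ) : HasFDerivAt (fun v => gradient U (verletPosition U h n x v))
      ((fderiv ℝ (gradient U) (verletPosition U h n x v)).comp
        (fderiv ℝ (verletPosition U h n x) v)) v :=
    (hU.differentiable_gradient _).hasFDerivAt.comp v
      ((differentiable_trajectory h hU x n).1 v).hasFDerivAt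
  have hp (n : ℕ) := ((differentiable_trajectory h hU x n).1 v).hasFDerivAt
  have hv (n : ℕ) := ((differentiable_trajectory h hU x n).2 v).hasFDerivAt
  refine ⟨fun n => ?_, fun n => ?_⟩
  · have : verletPosition U h (n + 1) x = _ := funext (verletPosition_succ U h n x)
    conv_lhs => rw [this]
    exact (((hp n).fun_add ((hv n).fun_const_smul h)).fun_sub
      ((hg n).fun_const_smul (h ^ 2 / 2))).fderiv
  · have : verletVelocity U h (n + 1) x = _ := funext (verletVelocity_succ U h n x)
    conv_lhs => rw [this]
    exact ((hv n).fun_sub (((hg n).fun_add (hg (n + 1))).fun_const_smul (h / 2))).fderiv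

lemma fderiv_verletPosition_zero (x v : E d) : fderiv ℝ (verletPosition U h 0 x) v = 0 :=
  (hasFDerivAt_const x v).fderiv

lemma fderiv_verletVelocity_zero (x v : E d) :
    fderiv ℝ (verletVelocity U h 0 x) v = ContinuousLinearMap.id ℝ (E d) :=
  (hasFDerivAt_id v).fderiv

end Trajectory

/-! ### Comparison of Verlet trajectories and Jacobians with free flight. -/

namespace StepSize

variable {d : ℕ} {U : E d → ℝ} {T h : ℝ} {N : ℕ}

lemma N_mul (hs : StepSize U T h N) : N * h = T := by
  rw [← hs.div, div_mul_cancel₀ _ hs.h_pos.ne']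

lemma L_mul_sq_le (hs : StepSize U T h N) (hU : Potential U) : L U * T ^ 2 ≤ 1 / 6 := by
  have := hs.bound
  have := mul_nonneg hU.L_nonneg (mul_nonneg hs.T_pos.le hs.h_pos.le)
  linarith

lemma norm_verletPosition_sub_le (hs : StepSize U T h N) (hU : Potential U) (x v y w : E d)
    {D : ℝ} (h0 : ‖x - y‖ ≤ D) (h1 : ‖x - y + T • (v - w)‖ ≤ D) {n : ℕ} (hn : n ≤ N) :
    ‖verletPosition U h n x v - verletPosition U h n y w‖ ≤ 12 / 11 * D := by
  have := (leapfrog_sub U h x v y w).norm_le hs.h_pos.le hs.T_pos hs.N_mul hU.L_nonneg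
    (hs.L_mul_sq_le hU) le_rfl (D := D) (fun _ _ => by
      simpa using hU.norm_gradient_sub_le _ _) h0 h1 n hn
  simpa using this

lemma norm_verletPosition_sub_sub_le (hs : StepSize U T h N) (hU : Potential U) (x v y w : E d)
    {D : ℝ} (h0 : ‖x - y‖ ≤ D) (h1 : ‖x - y + T • (v - w)‖ ≤ D) :
    ‖verletPosition U h N x v - verletPosition U h N y w - (x - y) - T • (v - w)‖ ≤ 1 / 11 * D :=
  (leapfrog_sub U h x v y w).norm_sub_le_of_growth hs.h_pos.le hs.T_pos hs.N_mul hU.L_nonneg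
    (hs.L_mul_sq_le hU) (D := D) (fun _ _ => hU.norm_gradient_sub_le _ _) h0 h1

lemma norm_fderiv_verletPosition_le (hs : StepSize U T h N) (hU : Potential U) (x v : E d)
    {n : ℕ} (hn : n ≤ N) : ‖fderiv ℝ (verletPosition U h n x) v‖ ≤ 12 / 11 * T := by
  have := (leapfrog_fderiv h hU x v).norm_le hs.h_pos.le hs.T_pos hs.N_mul hU.L_nonneg
    (hs.L_mul_sq_le hU) le_rfl (D := T) (fun _ _ => by
      rw [add_zero]
      exact (ContinuousLinearMap.opNorm_comp_le _ _).trans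
        (by gcongr; exact hU.norm_fderiv_gradient_le _))
    (by simpa [fderiv_verletPosition_zero] using hs.T_pos.le)
    (by
      rw [fderiv_verletPosition_zero, fderiv_verletVelocity_zero, zero_add, norm_smul,
        Real.norm_of_nonneg hs.T_pos.le]
      exact mul_le_of_le_one_right hs.T_pos.le ContinuousLinearMap.norm_id_le) n hn
  simpa using this

lemma norm_fderiv_verletPosition_sub_le (hs : StepSize U T h N) (hU : Potential U)
    (x v y w : E d) {D : ℝ} (h0 : ‖x - y‖ ≤ D) (h1 : ‖x - y + T • (v - w)‖ ≤ D) :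
    ‖fderiv ℝ (verletPosition U h N x) v - fderiv ℝ (verletPosition U h N y) w‖ ≤
      1 / 2 * (12 / 11) ^ 3 * LH U * T ^ 3 * D := by
  have hx := leapfrog_fderiv h hU x v
  have hy := leapfrog_fderiv h hU y w
  have hT := hs.T_pos
  have hL := hU.L_nonneg
  have hLH := hU.LH_nonneg
  have hD : 0 ≤ D := (norm_nonneg _).trans h0
  have hl : Leapfrog h
      (fun n => fderiv ℝ (verletPosition U h n x) v - fderiv ℝ (verletPosition U h n y) w)
      (fun n => fderiv ℝ (verletVelocity U h n x) v - fderiv ℝ (verletVelocity U h n y) w)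
      (fun n => (fderiv ℝ (gradient U) (verletPosition U h n x v)).comp
        (fderiv ℝ (verletPosition U h n x) v) -
        (fderiv ℝ (gradient U) (verletPosition U h n y w)).comp
        (fderiv ℝ (verletPosition U h n y) w)) :=
    ⟨fun n => by rw [hx.pos, hy.pos]; module, fun n => by rw [hx.vel, hy.vel]; module⟩
  -- The initial data vanish, so `D = 0` and everything comes from the source `β`: Lipschitz
  -- constant of the Hessian times the distance of positions times the size of the Jacobian.
  have := hl.norm_le hs.h_pos.le hT hs.N_mul hL
    (hs.L_mul_sq_le hU) (β := LH U * (12 / 11 * D) * (12 / 11 * T)) (by positivity) (D := 0)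
    (fun k hk => ?_) (by simp [fderiv_verletPosition_zero])
    (by simp [fderiv_verletPosition_zero, fderiv_verletVelocity_zero]) N le_rfl
  · refine this.trans (le_of_eq (by ring))
  · set H := fderiv ℝ (gradient U) (verletPosition U h k x v)
    set H' := fderiv ℝ (gradient U) (verletPosition U h k y w)
    set J := fderiv ℝ (verletPosition U h k x) v
    set J' := fderiv ℝ (verletPosition U h k y) w
    -- The first summand is the linear growth term, the second is the source `β`.
    have e : H.comp J - H'.comp J' = H.comp (J - J') + (H - H').comp J' := by
      simp only [ContinuousLinearMap.comp_sub, ContinuousLinearMap.sub_comp]; abel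
    rw [e]
    refine (norm_add_le _ _).trans ?_
    gcongr
    · exact (ContinuousLinearMap.opNorm_comp_le _ _).trans
        (by gcongr; exact hU.norm_fderiv_gradient_le _)
    · refine (ContinuousLinearMap.opNorm_comp_le _ _).trans ?_
      gcongr
      · exact (hU.norm_fderiv_gradient_sub_le _ _).trans
          (by gcongr; exact hs.norm_verletPosition_sub_le hU x v y w h0 h1 hk.le)
      · exact hs.norm_fderiv_verletPosition_le hU y w hk.le

end StepSize

/-! ### A lower bound for the determinant of a perturbation of the identity -/

/-- Every complex eigenvalue of a real matrix is bounded by its Euclidean operator norm. -/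
lemma norm_root_charpoly_le {d : ℕ} (A : E d →L[ℝ] E d) {z : ℂ}
    (hz : z ∈ (((LinearMap.toMatrix (EuclideanSpace.basisFun (Fin d) ℝ).toBasis
      (EuclideanSpace.basisFun (Fin d) ℝ).toBasis A.toLinearMap).map
        (algebraMap ℝ ℂ)).charpoly.roots)) : ‖z‖ ≤ ‖A‖ := by
  set b := EuclideanSpace.basisFun (Fin d) ℝ
  set M := LinearMap.toMatrix b.toBasis b.toBasis A.toLinearMap with hM
  have hz' : Module.End.HasEigenvalue (Matrix.toLin' (M.map (algebraMap ℝ ℂ))) z := by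
    rw [Module.End.hasEigenvalue_iff_isRoot_charpoly, Matrix.charpoly_toLin']
    exact Polynomial.isRoot_of_mem_roots hz
  obtain ⟨u, hu, hu0⟩ := hz'.exists_hasEigenvector
  rw [Module.End.mem_eigenspace_iff, Matrix.toLin'_apply] at hu
  have hAM (y : E d) (i : Fin d) : A y i = ∑ j, M i j * y j := by
    have := LinearMap.toMatrix_mulVec_repr b.toBasis b.toBasis A.toLinearMap y
    have := congrFun this i
    simpa [Matrix.mulVec, dotProduct, b] using this.symm
  -- Split the complex eigenvector into real and imaginary parts. The real operator bound applies to
  -- each, and the squares add up to the modulus.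
  set x : E d := WithLp.toLp 2 fun i => (u i).re
  set y : E d := WithLp.toLp 2 fun i => (u i).im
  have hi (i : Fin d) : ∑ j, (M i j : ℂ) * u j = z * u i := by
    simpa [Matrix.mulVec, dotProduct] using congrFun hu i
  have hre (i : Fin d) : A x i = (z * u i).re := by
    rw [hAM, ← hi]; simp [x]
  have him (i : Fin d) : A y i = (z * u i).im := by
    rw [hAM, ← hi]; simp [y]
  have hsq : ‖A x‖ ^ 2 + ‖A y‖ ^ 2 = ‖z‖ ^ 2 * (‖x‖ ^ 2 + ‖y‖ ^ 2) := by
    simp only [EuclideanSpace.norm_sq_eq, ← Finset.sum_add_distrib, Finset.mul_sum]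
    refine Finset.sum_congr rfl fun i _ => ?_
    rw [hre, him]
    simp only [x, y, Real.norm_eq_abs, sq_abs]
    have h1 := Complex.sq_norm (z * u i)
    have h2 := Complex.sq_norm (u i)
    rw [Complex.normSq_apply] at h1 h2
    rw [norm_mul, mul_pow, h2] at h1
    linarith
  have hpos : 0 < ‖x‖ ^ 2 + ‖y‖ ^ 2 := by
    by_contra hcon
    have hx : ‖x‖ ^ 2 = 0 := by nlinarith [sq_nonneg ‖x‖, sq_nonneg ‖y‖]
    have hy : ‖y‖ ^ 2 = 0 := by nlinarith [sq_nonneg ‖x‖, sq_nonneg ‖y‖]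
    have hx : x = 0 := by simpa using hx
    have hy : y = 0 := by simpa using hy
    refine hu0 (funext fun i => Complex.ext ?_ ?_)
    · exact congrArg (fun w : E d => w i) hx
    · exact congrArg (fun w : E d => w i) hy
  have h1 : ‖A x‖ ^ 2 ≤ ‖A‖ ^ 2 * ‖x‖ ^ 2 := by
    rw [← mul_pow]; gcongr; exact A.le_opNorm x
  have h2 : ‖A y‖ ^ 2 ≤ ‖A‖ ^ 2 * ‖y‖ ^ 2 := by
    rw [← mul_pow]; gcongr; exact A.le_opNorm y
  refine le_of_sq_le_sq ?_ (norm_nonneg _)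
  nlinarith

/-- This is a second-order lower bound for `log |1 + z|`. After squaring, `exp u ≤ 1 / (1 - u)`
reduces it to a polynomial inequality in `r = z.re` and `s = ‖z‖`, written as a sum of nonnegative
terms when `|r| ≤ s ≤ 1/2`. -/
lemma exp_re_sub_sq_le_norm_one_add {z : ℂ} (hz : ‖z‖ ≤ 1 / 2) :
    Real.exp (z.re - 4 * ‖z‖ ^ 2) ≤ ‖1 + z‖ := by
  have hre : |z.re| ≤ ‖z‖ := Complex.abs_re_le_norm z
  have hsq : ‖1 + z‖ ^ 2 = 1 + (2 * z.re + ‖z‖ ^ 2) := by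
    rw [Complex.sq_norm, Complex.sq_norm, Complex.normSq_apply, Complex.normSq_apply]
    simp; ring
  refine le_of_sq_le_sq ?_ (norm_nonneg _)
  rw [hsq, ← Real.exp_nat_mul]
  have h0 := norm_nonneg z
  obtain ⟨h1, h2⟩ := abs_le.1 hre
  generalize z.re = r at *
  generalize ‖z‖ = s at *
  push_cast
  set u := 2 * (r - 4 * s ^ 2) with hu
  have hu1 : 0 < 1 - u := by nlinarith
  have he : (1 - u) * Real.exp u ≤ 1 := by
    have := Real.add_one_le_exp (-u)
    calc (1 - u) * Real.exp u ≤ Real.exp (-u) * Real.exp u := by gcongr; linarith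
      _ = 1 := by rw [← Real.exp_add]; simp
  refine le_of_mul_le_mul_left (he.trans ?_) hu1
  have e : (1 - u) * (1 + (2 * r + s ^ 2)) - 1 =
      4 * ((s - r) * (s + r)) + 14 * (s ^ 2 * (s + r)) + s ^ 2 * ((1 - 2 * s) * (5 - 4 * s)) := by
    rw [hu]; ring
  have : 0 ≤ 4 * ((s - r) * (s + r)) + 14 * (s ^ 2 * (s + r)) +
      s ^ 2 * ((1 - 2 * s) * (5 - 4 * s)) := by
    have a1 : 0 ≤ s - r := by linarith
    have a2 : 0 ≤ s + r := by linarith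
    have a3 : 0 ≤ 1 - 2 * s := by linarith
    have a4 : 0 ≤ 5 - 4 * s := by linarith
    positivity
  linarith

/-- A lower bound for the Jacobian determinant of a small perturbation of the identity. -/
lemma exp_trace_sub_le_abs_det {d : ℕ} (A : E d →L[ℝ] E d) (hA : ‖A‖ ≤ 1 / 2) :
    Real.exp (LinearMap.trace ℝ (E d) A.toLinearMap - 4 * d * ‖A‖ ^ 2) ≤
      |(ContinuousLinearMap.id ℝ (E d) + A).det| := by
  set b := (EuclideanSpace.basisFun (Fin d) ℝ).toBasis with hb
  set M := LinearMap.toMatrix b b A.toLinearMap with hM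
  set R := (M.map (algebraMap ℝ ℂ)).charpoly.roots with hR
  have hroot : ∀ z ∈ R, ‖z‖ ≤ ‖A‖ := fun z hz => norm_root_charpoly_le A hz
  have htr : LinearMap.trace ℝ (E d) A.toLinearMap = (R.map Complex.re).sum := by
    have h1 := Matrix.trace_eq_sum_roots_charpoly (M.map (algebraMap ℝ ℂ))
    have h2 : (M.map (algebraMap ℝ ℂ)).trace = (M.trace : ℂ) := by
      simp [Matrix.trace]
    rw [LinearMap.trace_eq_matrix_trace ℝ b]
    have h3 := congrArg Complex.re (h2.symm.trans h1)
    rw [Complex.ofReal_re] at h3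
    rw [h3]
    exact map_multiset_sum Complex.reAddGroupHom R
  have hcard : R.card = d := by
    have := (IsAlgClosed.splits (M.map (algebraMap ℝ ℂ)).charpoly).natDegree_eq_card_roots
    rw [hR, ← this, Matrix.charpoly_natDegree_eq_dim, Fintype.card_fin]
  have hdet : |(ContinuousLinearMap.id ℝ (E d) + A).det| = (R.map fun z => ‖1 + z‖).prod := by
    have h1 : (ContinuousLinearMap.id ℝ (E d) + A).det = (1 + M).det := by
      rw [ContinuousLinearMap.det, ← LinearMap.det_toMatrix b]
      congr 1
      rw [ContinuousLinearMap.toLinearMap_add, map_add]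
      simp [hM]
    have h2 : ((1 + M).det : ℂ) = (1 + M.map (algebraMap ℝ ℂ)).det := by
      have := RingHom.map_det (algebraMap ℝ ℂ) (1 + M)
      rw [map_add, map_one] at this
      exact this
    have h3 := (IsAlgClosed.splits (M.map (algebraMap ℝ ℂ)).charpoly).eq_prod_roots_of_monic
      (Matrix.charpoly_monic _)
    -- The characteristic polynomial at `-1` is `det (1 + M)` up to sign, which becomes the product
    -- of `|1 + z|` over the eigenvalues.
    have h4 := congrArg (Polynomial.eval (-1)) h3
    rw [Matrix.eval_charpoly, Polynomial.eval_multiset_prod, Multiset.map_map] at h4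
    have h5 : Matrix.scalar (Fin d) (-1 : ℂ) - M.map (algebraMap ℝ ℂ) =
        -(1 + M.map (algebraMap ℝ ℂ)) := by
      rw [map_neg, map_one]; abel
    rw [h5, Matrix.det_neg] at h4
    have h6 := congrArg norm h4
    rw [norm_mul, norm_pow, norm_neg, norm_one, one_pow, one_mul, ← h2, Complex.norm_real,
      Real.norm_eq_abs] at h6
    rw [h1, h6]
    have h7 : ∀ S : Multiset ℂ, ‖S.prod‖ = (S.map norm).prod := fun S =>
      map_multiset_prod (normHom : ℂ →*₀ ℝ) S
    rw [h7, Multiset.map_map]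
    congr 1
    refine Multiset.map_congr rfl fun z _ => ?_
    simp only [Function.comp, Polynomial.eval_sub, Polynomial.eval_X, Polynomial.eval_C]
    rw [← norm_neg]; congr 1; ring
  rw [hdet, htr]
  calc Real.exp ((R.map Complex.re).sum - 4 * d * ‖A‖ ^ 2)
      = (R.map fun z => Real.exp (z.re - 4 * ‖A‖ ^ 2)).prod := by
        have hd : (d : ℝ) = R.card := by rw [hcard]
        rw [hd]
        clear_value R
        clear hR hroot htr hcard hdet hd
        induction R using Multiset.induction_on with
        | empty => simp
        | cons z R ih =>
          simp only [Multiset.map_cons, Multiset.prod_cons, Multiset.sum_cons, Multiset.card_cons]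
          rw [← ih, ← Real.exp_add]
          congr 1; push_cast; ring
    _ ≤ _ := by
        refine Multiset.prod_map_le_prod_map₀ _ _ (fun z _ => (Real.exp_pos _).le) fun z hz => ?_
        refine le_trans ?_ (exp_re_sub_sq_le_norm_one_add ((hroot z hz).trans hA))
        have := hroot z hz
        gcongr

/-! ### The standard Gaussian measure: density, integration by parts, change of variables -/

/-- Lebesgue density of the standard Gaussian measure. -/
def gaussianDensity (d : ℕ) (v : E d) : ℝ :=
  ((2 * Real.pi) ^ (d / 2 : ℝ))⁻¹ * Real.exp (-(‖v‖ ^ 2 / 2))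

section Gaussian

variable {d : ℕ}

lemma gaussianDensity_pos (v : E d) : 0 < gaussianDensity d v := by
  unfold gaussianDensity; positivity

@[fun_prop]
lemma measurable_gaussianDensity : Measurable (gaussianDensity d) := by
  unfold gaussianDensity; fun_prop

lemma integrable_gaussianDensity : Integrable (gaussianDensity d) := by
  refine Integrable.const_mul ?_ _
  have := (GaussianFourier.integrable_cexp_neg_mul_sq_norm_add (V := E d) (b := 1 / 2)
    (by norm_num) 0 0).norm
  refine this.congr (Filter.Eventually.of_forall fun v => ?_)
  simp only [Complex.norm_exp]
  congr 1
  have : (-(1 / 2 : ℂ) * (‖v‖ : ℂ) ^ 2 + 0 * ((inner ℝ (0 : E d) v : ℝ) : ℂ)) =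
      ((-(‖v‖ ^ 2 / 2) : ℝ) : ℂ) := by push_cast; ring
  rw [this, Complex.ofReal_re]

lemma stdGaussian_eq_withDensity :
    stdGaussian (E d) = volume.withDensity fun v => ENNReal.ofReal (gaussianDensity d v) := by
  have : IsFiniteMeasure (volume.withDensity fun v => ENNReal.ofReal (gaussianDensity d v)) :=
    isFiniteMeasure_withDensity_ofReal integrable_gaussianDensity.2
  -- Both measures are finite, so it suffices to compare characteristic functions.
  refine Measure.ext_of_charFun (funext fun t => ?_)
  rw [charFun_stdGaussian, charFun_apply,
    integral_withDensity_eq_integral_toReal_smul (by fun_prop) (by simp)]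
  have hI := GaussianFourier.integral_cexp_neg_mul_sq_norm_add (V := E d) (b := 1 / 2)
    (by norm_num) Complex.I t
  have hc : ((Real.pi : ℂ) / (1 / 2)) ^ ((Module.finrank ℝ (E d) : ℂ) / 2) =
      (((2 * Real.pi) ^ (d / 2 : ℝ) : ℝ) : ℂ) := by
    rw [Complex.ofReal_cpow (by positivity), finrank_euclideanSpace_fin]
    push_cast; congr 1; ring
  rw [hc] at hI
  have e (v : E d) : (ENNReal.ofReal (gaussianDensity d v)).toReal •
      Complex.exp ((inner ℝ v t : ℝ) * Complex.I) =
      ((((2 * Real.pi) ^ (d / 2 : ℝ))⁻¹ : ℝ) : ℂ) *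
        Complex.exp (-(1 / 2) * ‖v‖ ^ 2 + Complex.I * (inner ℝ t v : ℝ)) := by
    rw [ENNReal.toReal_ofReal (gaussianDensity_pos v).le, gaussianDensity, Complex.real_smul,
      Complex.ofReal_mul, mul_assoc, Complex.ofReal_exp, ← Complex.exp_add, real_inner_comm]
    congr 2; push_cast; ring
  simp_rw [e]
  rw [integral_const_mul, hI, ← mul_assoc, ← Complex.ofReal_mul, inv_mul_cancel₀ (by positivity)]
  simp only [Complex.ofReal_one, one_mul, Complex.I_sq]
  congr 1; ring

lemma integrable_stdGaussian_iff {f : E d → ℝ} :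
    Integrable f (stdGaussian (E d)) ↔ Integrable fun v => gaussianDensity d v * f v := by
  rw [stdGaussian_eq_withDensity,
    integrable_withDensity_iff_integrable_smul' (by fun_prop) (by simp)]
  simp only [ENNReal.toReal_ofReal (gaussianDensity_pos _).le, smul_eq_mul]

lemma setIntegral_stdGaussian {f : E d → ℝ} {s : Set (E d)} (hs : MeasurableSet s) :
    ∫ v in s, f v ∂(stdGaussian (E d)) = ∫ v in s, gaussianDensity d v * f v := by
  rw [stdGaussian_eq_withDensity,
    setIntegral_withDensity_eq_setIntegral_toReal_smul (by fun_prop) (by simp) _ hs]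
  simp only [ENNReal.toReal_ofReal (gaussianDensity_pos _).le, smul_eq_mul]

lemma integral_stdGaussian {f : E d → ℝ} :
    ∫ v, f v ∂(stdGaussian (E d)) = ∫ v, gaussianDensity d v * f v := by
  simpa using setIntegral_stdGaussian (f := f) MeasurableSet.univ

lemma hasFDerivAt_gaussianDensity (v : E d) :
    HasFDerivAt (gaussianDensity d) (-(gaussianDensity d v) • innerSL ℝ v) v := by
  have h1 := (((hasStrictFDerivAt_norm_sq v).hasFDerivAt.const_mul (1 / 2 : ℝ)).neg.exp).const_mul
    (((2 * Real.pi) ^ (d / 2 : ℝ))⁻¹)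
  have : gaussianDensity d = fun v => ((2 * Real.pi) ^ (d / 2 : ℝ))⁻¹ *
      Real.exp (-(1 / 2 * ‖v‖ ^ 2)) := by
    funext v; simp only [gaussianDensity]; congr 3; ring
  rw [this]
  refine HasFDerivAt.congr_fderiv h1 ?_
  ext w
  simp
  ring

lemma integrable_norm_stdGaussian : Integrable (fun v : E d => ‖v‖) (stdGaussian (E d)) :=
  (IsGaussian.integrable_id (μ := stdGaussian (E d))).norm

/-- Measurable functions of linear growth are integrable for the Gaussian measure. -/
lemma integrable_stdGaussian_of_le {f : E d → ℝ} (hf : Measurable f) {a b : ℝ}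
    (h : ∀ v, |f v| ≤ a + b * ‖v‖) : Integrable f (stdGaussian (E d)) := by
  refine Integrable.mono' (g := fun v => a + b * ‖v‖) ?_ hf.aestronglyMeasurable
    (Filter.Eventually.of_forall h)
  exact (integrable_const a).add (integrable_norm_stdGaussian.const_mul b)

/-- Gaussian integration by parts in one direction. -/
lemma integral_inner_mul_eq {f : E d → ℝ} (hf : Differentiable ℝ f) {a b : ℝ}
    (ha : ∀ v, |f v| ≤ a) (hb : ∀ v, ‖fderiv ℝ f v‖ ≤ b) (e : E d) :
    ∫ v, inner ℝ v e * f v ∂(stdGaussian (E d)) = ∫ v, fderiv ℝ f v e ∂(stdGaussian (E d)) := by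
  have ha0 : 0 ≤ a := (abs_nonneg _).trans (ha 0)
  have hfm : Measurable f := hf.continuous.measurable
  have hdm : Measurable fun v => fderiv ℝ f v e := measurable_fderiv_apply_const ℝ f e
  have i1 : Integrable (fun v => inner ℝ v e * f v) (stdGaussian (E d)) := by
    refine integrable_stdGaussian_of_le (by fun_prop) (a := 0) (b := ‖e‖ * a) fun v => ?_
    rw [abs_mul, zero_add]
    calc |inner ℝ v e| * |f v| ≤ (‖v‖ * ‖e‖) * a := by
          gcongr
          · exact abs_real_inner_le_norm v e
          · exact ha v
      _ = _ := by ring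
  have i2 : Integrable (fun v => fderiv ℝ f v e) (stdGaussian (E d)) := by
    refine integrable_stdGaussian_of_le hdm (a := b * ‖e‖) (b := 0) fun v => ?_
    rw [zero_mul, add_zero, ← Real.norm_eq_abs]
    exact (ContinuousLinearMap.le_opNorm _ _).trans (by gcongr; exact hb v)
  have i3 : Integrable f (stdGaussian (E d)) :=
    integrable_stdGaussian_of_le hfm (a := a) (b := 0) fun v => by simpa using ha v
  rw [integrable_stdGaussian_iff] at i1 i2 i3
  have hd (v : E d) : fderiv ℝ (gaussianDensity d) v e =
      -(gaussianDensity d v * inner ℝ v e) := by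
    rw [(hasFDerivAt_gaussianDensity v).fderiv]; simp
  have := integral_mul_fderiv_eq_neg_fderiv_mul_of_integrable (f := f) (g := gaussianDensity d)
    (v := e) (μ := volume) (by simpa only [mul_comm] using i2)
    (by
      refine i1.neg.congr (Filter.Eventually.of_forall fun v => ?_)
      simp only [hd, Pi.neg_apply]; ring)
    (by simpa only [mul_comm] using i3)
    (fun v _ => hf v) (fun v _ => (hasFDerivAt_gaussianDensity v).differentiableAt)
  rw [integral_stdGaussian, integral_stdGaussian]
  simp only [hd] at this
  rw [← neg_inj, ← integral_neg]
  calc _ = _ := by congr 1; funext v; ring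
    _ = _ := this
    _ = _ := by congr 2; funext v; ring

/-- Gaussian integration by parts: `E[⟨v, g⟩] = E[tr Dg]`. -/
lemma integral_inner_eq_integral_trace {g : E d → E d} (hg : Differentiable ℝ g) {a b : ℝ}
    (ha : ∀ v, ‖g v‖ ≤ a) (hb : ∀ v, ‖fderiv ℝ g v‖ ≤ b) :
    Integrable (fun v => inner ℝ v (g v) -
        LinearMap.trace ℝ (E d) (fderiv ℝ g v).toLinearMap) (stdGaussian (E d)) ∧
      ∫ v, (inner ℝ v (g v) - LinearMap.trace ℝ (E d) (fderiv ℝ g v).toLinearMap)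
        ∂(stdGaussian (E d)) = 0 := by
  set e := EuclideanSpace.basisFun (Fin d) ℝ with he
  set f : Fin d → E d → ℝ := fun i v => inner ℝ (e i) (g v) with hf
  have hfd (i : Fin d) (v : E d) : HasFDerivAt (f i) ((innerSL ℝ (e i)).comp (fderiv ℝ g v)) v :=
    (innerSL ℝ (e i)).hasFDerivAt.comp v (hg v).hasFDerivAt
  have hfe (i : Fin d) (v : E d) : fderiv ℝ (f i) v (e i) = inner ℝ (e i) (fderiv ℝ g v (e i)) := by
    rw [(hfd i v).fderiv]; simp
  have hn (i : Fin d) : ‖e i‖ = 1 := e.orthonormal.1 i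
  have hfa (i : Fin d) (v : E d) : |f i v| ≤ a := by
    refine (abs_real_inner_le_norm _ _).trans ?_
    rw [hn, one_mul]; exact ha v
  have hfb (i : Fin d) (v : E d) : ‖fderiv ℝ (f i) v‖ ≤ b := by
    rw [(hfd i v).fderiv]
    refine (ContinuousLinearMap.opNorm_comp_le _ _).trans ?_
    rw [innerSL_apply_norm, hn, one_mul]; exact hb v
  have hpt (v : E d) : inner ℝ v (g v) - LinearMap.trace ℝ (E d) (fderiv ℝ g v).toLinearMap =
      ∑ i, (inner ℝ v (e i) * f i v - fderiv ℝ (f i) v (e i)) := by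
    rw [LinearMap.trace_eq_sum_inner _ e, Finset.sum_sub_distrib, ← e.sum_inner_mul_inner v (g v)]
    simp only [hfe]
    simp [hf]
  have i1 (i : Fin d) : Integrable (fun v => inner ℝ v (e i) * f i v) (stdGaussian (E d)) := by
    have hdf : Differentiable ℝ (f i) := fun v => (hfd i v).differentiableAt
    have hm : Measurable (f i) := hdf.continuous.measurable
    refine integrable_stdGaussian_of_le (by fun_prop) (a := 0) (b := a) fun v => ?_
    rw [abs_mul, zero_add, mul_comm a]
    gcongr
    · simpa [hn] using abs_real_inner_le_norm v (e i)
    · exact hfa i v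
  have i2 (i : Fin d) : Integrable (fun v => fderiv ℝ (f i) v (e i)) (stdGaussian (E d)) := by
    refine integrable_stdGaussian_of_le (measurable_fderiv_apply_const ℝ (f i) (e i))
      (a := b) (b := 0) fun v => ?_
    rw [zero_mul, add_zero, ← Real.norm_eq_abs]
    refine (ContinuousLinearMap.le_opNorm _ _).trans ?_
    rw [hn, mul_one]; exact hfb i v
  simp_rw [hpt]
  have i3 (i : Fin d) : Integrable (fun v => inner ℝ v (e i) * f i v - fderiv ℝ (f i) v (e i))
      (stdGaussian (E d)) := (i1 i).sub (i2 i)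
  refine ⟨integrable_finsetSum _ fun i _ => i3 i, ?_⟩
  rw [integral_finsetSum _ fun i _ => i3 i]
  refine Finset.sum_eq_zero fun i _ => ?_
  rw [integral_sub (i1 i) (i2 i), sub_eq_zero]
  exact integral_inner_mul_eq (fun v => (hfd i v).differentiableAt) (hfa i) (hfb i) (e i)

/-- Density, relative to the standard Gaussian measure, of its pullback under a map `Ψ` with
derivative `Ψ'`. -/
def jacobianDensity (Ψ : E d → E d) (Ψ' : E d → E d →L[ℝ] E d) (v : E d) : ℝ :=
  |(Ψ' v).det| * Real.exp (‖v‖ ^ 2 / 2 - ‖Ψ v‖ ^ 2 / 2)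

lemma gaussianDensity_mul_jacobianDensity (Ψ : E d → E d) (Ψ' : E d → E d →L[ℝ] E d) (v : E d) :
    gaussianDensity d v * jacobianDensity Ψ Ψ' v = |(Ψ' v).det| • gaussianDensity d (Ψ v) := by
  have : Real.exp (-(‖Ψ v‖ ^ 2 / 2)) =
      Real.exp (-(‖v‖ ^ 2 / 2)) * Real.exp (‖v‖ ^ 2 / 2 - ‖Ψ v‖ ^ 2 / 2) := by
    rw [← Real.exp_add]; congr 1; ring
  simp only [gaussianDensity, jacobianDensity, smul_eq_mul, this]; ring

lemma integrable_jacobianDensity {Ψ : E d → E d} {Ψ' : E d → E d →L[ℝ] E d}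
    (hΨ : Function.Injective Ψ) (hd : ∀ v, HasFDerivAt Ψ (Ψ' v) v) :
    Integrable (jacobianDensity Ψ Ψ') (stdGaussian (E d)) := by
  rw [integrable_stdGaussian_iff]
  simp only [gaussianDensity_mul_jacobianDensity]
  have := (integrableOn_image_iff_integrableOn_abs_det_fderiv_smul volume MeasurableSet.univ
    (fun v _ => (hd v).hasFDerivWithinAt) hΨ.injOn (gaussianDensity d)).1
    integrable_gaussianDensity.integrableOn
  rwa [integrableOn_univ] at this

lemma setIntegral_jacobianDensity {Ψ : E d → E d} {Ψ' : E d → E d →L[ℝ] E d}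
    (hΨ : Function.Bijective Ψ) (hd : ∀ v, HasFDerivAt Ψ (Ψ' v) v) {A : Set (E d)}
    (hA : MeasurableSet A) :
    ∫ v in Ψ ⁻¹' A, jacobianDensity Ψ Ψ' v ∂(stdGaussian (E d)) = (stdGaussian (E d)).real A := by
  have hdΨ : Differentiable ℝ Ψ := fun v => (hd v).differentiableAt
  have hm : Measurable Ψ := hdΨ.continuous.measurable
  rw [setIntegral_stdGaussian (hm hA)]
  simp only [gaussianDensity_mul_jacobianDensity]
  rw [← integral_image_eq_integral_abs_det_fderiv_smul volume (hm hA)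
    (fun v _ => (hd v).hasFDerivWithinAt) hΨ.1.injOn, Set.image_preimage_eq _ hΨ.2]
  have := setIntegral_stdGaussian (f := fun _ => (1 : ℝ)) hA
  simp only [mul_one] at this
  rw [← this]; simp

end Gaussian

/-! ### Total variation distance between a Gaussian and its image under a small displacement -/

/-- A pointwise Pinsker inequality. With `t = r²`, `(1 - r)²` is a Hellinger term bounded by the
entropy term through `log r ≤ r - 1`. The weight `l` replaces Cauchy–Schwarz, so only integrals
linear in the entropy and in `t` occur. -/
lemma abs_one_sub_le {t l : ℝ} (ht : 0 < t) (hl : 0 < l) :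
    |1 - t| ≤ l / 2 * (t - 1 - Real.log t) + 1 / l * (1 + t) := by
  obtain ⟨r, hr, rfl⟩ : ∃ r : ℝ, 0 < r ∧ t = r ^ 2 :=
    ⟨√t, Real.sqrt_pos.2 ht, (Real.sq_sqrt ht.le).symm⟩
  have hlog : Real.log (r ^ 2) ≤ 2 * (r - 1) := by
    rw [Real.log_pow]; push_cast
    linarith [Real.log_le_sub_one_of_pos hr]
  have h1 : l / 2 * (1 - r) ^ 2 ≤ l / 2 * (r ^ 2 - 1 - Real.log (r ^ 2)) := by
    gcongr; nlinarith
  have h2 : 1 / l * ((1 + r) ^ 2 / 2) ≤ 1 / l * (1 + r ^ 2) := by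
    gcongr; nlinarith [sq_nonneg (1 - r)]
  have h3 : |1 - r ^ 2| = |1 - r| * (1 + r) := by
    have : 1 - r ^ 2 = (1 - r) * (1 + r) := by ring
    rw [this, abs_mul, abs_of_pos (by linarith : 0 < 1 + r)]
  have h4 : |1 - r| * (1 + r) ≤ l / 2 * (1 - r) ^ 2 + 1 / l * ((1 + r) ^ 2 / 2) := by
    have e : l / 2 * (1 - r) ^ 2 + 1 / l * ((1 + r) ^ 2 / 2) - |1 - r| * (1 + r) =
        1 / (2 * l) * (l * |1 - r| - (1 + r)) ^ 2 := by
      rw [← sq_abs (1 - r)]; field_simp; ring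
    have : 0 ≤ 1 / (2 * l) * (l * |1 - r| - (1 + r)) ^ 2 := by positivity
    linarith
  linarith

/-- The integrals over `s` and its complement cancel, so each carries at most half of the `L¹` norm.
-/
lemma abs_setIntegral_le_half {X : Type*} [MeasurableSpace X] {μ : Measure X} {f : X → ℝ}
    (hf : Integrable f μ) (h0 : ∫ x, f x ∂μ = 0) {s : Set X} (hs : MeasurableSet s) :
    |∫ x in s, f x ∂μ| ≤ 1 / 2 * ∫ x, |f x| ∂μ := by
  have h1 := integral_add_compl hs hf
  have h2 := integral_add_compl hs hf.abs
  have h3 := abs_integral_le_integral_abs (f := f) (μ := μ.restrict s)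
  have h4 := abs_integral_le_integral_abs (f := f) (μ := μ.restrict sᶜ)
  have h5 : ∫ x in sᶜ, f x ∂μ = -∫ x in s, f x ∂μ := by linarith
  rw [h5, abs_neg] at h4
  linarith

/-- The difference is the integral of `1 - ρ` over `Ψ ⁻¹' A`, with `ρ` the density of the
pulled-back Gaussian. Only the lower bound `log ρ ≥ -(X + K)` is needed, and `X` integrates to zero,
so `K` bounds the relative entropy. -/
lemma abs_stdGaussian_sub_preimage_le {d : ℕ} {g : E d → E d} (hg : Differentiable ℝ g) {a b : ℝ}
    (ha0 : 0 < a) (ha : ∀ v, ‖g v‖ ≤ a) (hb : ∀ v, ‖fderiv ℝ g v‖ ≤ b) (hb2 : b ≤ 1 / 2)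
    (hbij : Function.Bijective fun v => v + g v) {A : Set (E d)} (hA : MeasurableSet A) :
    |(stdGaussian (E d)).real ((fun v => v + g v) ⁻¹' A) - (stdGaussian (E d)).real A| ≤
      √(a ^ 2 / 2 + 4 * d * b ^ 2) := by
  set γ := stdGaussian (E d)
  set Ψ : E d → E d := fun v => v + g v with hΨ
  set Ψ' : E d → E d →L[ℝ] E d := fun v => ContinuousLinearMap.id ℝ (E d) + fderiv ℝ g v with hΨ'
  have hd (v : E d) : HasFDerivAt Ψ (Ψ' v) v := (hasFDerivAt_id v).add (hg v).hasFDerivAt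
  have hΨm : Measurable Ψ := (continuous_id.add hg.continuous).measurable
  set ρ := jacobianDensity Ψ Ψ' with hρ
  have hρi : Integrable ρ γ := integrable_jacobianDensity hbij.1 hd
  have hρs {B : Set (E d)} (hB : MeasurableSet B) : ∫ v in Ψ ⁻¹' B, ρ v ∂γ = γ.real B :=
    setIntegral_jacobianDensity hbij hd hB
  have hρ1 : ∫ v, ρ v ∂γ = 1 := by simpa using hρs MeasurableSet.univ
  set K := a ^ 2 / 2 + 4 * d * b ^ 2 with hK
  have hK0 : 0 < K := by positivity
  obtain ⟨hXi, hX0⟩ := integral_inner_eq_integral_trace hg ha hb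
  set X : E d → ℝ := fun v =>
    inner ℝ v (g v) - LinearMap.trace ℝ (E d) (fderiv ℝ g v).toLinearMap with hX
  have hlow (v : E d) : Real.exp (-(X v + K)) ≤ ρ v := by
    have h1 := exp_trace_sub_le_abs_det (fderiv ℝ g v) ((hb v).trans hb2)
    have h2 : ‖v‖ ^ 2 / 2 - ‖Ψ v‖ ^ 2 / 2 = -inner ℝ v (g v) - ‖g v‖ ^ 2 / 2 := by
      simp only [hΨ, norm_add_sq_real]; ring
    have h3 : ‖g v‖ ^ 2 ≤ a ^ 2 := by gcongr; exact ha v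
    have h4 : 4 * d * ‖fderiv ℝ g v‖ ^ 2 ≤ 4 * d * b ^ 2 := by gcongr; exact hb v
    calc Real.exp (-(X v + K))
        ≤ Real.exp (LinearMap.trace ℝ (E d) (fderiv ℝ g v).toLinearMap -
            4 * d * ‖fderiv ℝ g v‖ ^ 2) * Real.exp (‖v‖ ^ 2 / 2 - ‖Ψ v‖ ^ 2 / 2) := by
          rw [← Real.exp_add, h2]
          refine Real.exp_le_exp.2 ?_
          simp only [hX, hK]; linarith
      _ ≤ ρ v := by
          simp only [hρ, jacobianDensity]
          gcongr
  have hpt (l : ℝ) (hl : 0 < l) (v : E d) :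
      |1 - ρ v| ≤ l / 2 * (ρ v - 1 + (X v + K)) + 1 / l * (1 + ρ v) := by
    have hpos : 0 < ρ v := (Real.exp_pos _).trans_le (hlow v)
    refine (abs_one_sub_le hpos hl).trans ?_
    have := (Real.le_log_iff_exp_le hpos).2 (hlow v)
    gcongr
    linarith
  have hfi : Integrable (fun v => 1 - ρ v) γ := (integrable_const _).sub hρi
  have hf0 : ∫ v, (1 - ρ v) ∂γ = 0 := by
    rw [integral_sub (integrable_const _) hρi, hρ1]; simp
  have hTV := abs_setIntegral_le_half hfi hf0 (hΨm hA)
  rw [integral_sub (integrable_const _).integrableOn hρi.integrableOn, hρs hA] at hTV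
  simp only [integral_const, MeasurableSet.univ, measureReal_restrict_apply, Set.univ_inter,
    smul_eq_mul, mul_one] at hTV
  refine hTV.trans ?_
  -- This `l` minimizes `l K / 2 + 2 / l`, with minimum `2 √K`; the factor `1/2` from mean zero
  -- leaves `√K`.
  set l := 2 / √K with hl
  have hs : 0 < √K := Real.sqrt_pos.2 hK0
  have hl0 : 0 < l := by positivity
  have i1 : Integrable (fun v => ρ v - 1) γ := hρi.sub (integrable_const _)
  have i2 : Integrable (fun v => X v + K) γ := hXi.add (integrable_const _)
  have i3 : Integrable (fun v => 1 + ρ v) γ := (integrable_const _).add hρi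
  have hint : ∫ v, |1 - ρ v| ∂γ ≤ l / 2 * K + 1 / l * 2 := by
    refine (integral_mono hfi.abs (((i1.add i2).const_mul _).add (i3.const_mul _))
      (hpt l hl0)).trans (le_of_eq ?_)
    have e1 : ∫ v, (ρ v - 1) ∂γ = 0 := by
      rw [integral_sub hρi (integrable_const _), hρ1]; simp
    have e2 : ∫ v, (X v + K) ∂γ = K := by
      rw [integral_add hXi (integrable_const _), hX0]; simp
    have e3 : ∫ v, (1 + ρ v) ∂γ = 2 := by
      rw [integral_add (integrable_const _) hρi, hρ1]; simp; norm_num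
    rw [integral_add' ((i1.add i2).const_mul _) (i3.const_mul _), integral_const_mul,
      integral_const_mul, integral_add' i1 i2, e1, e2, e3]
    ring
  have hKK : √K * √K = K := Real.mul_self_sqrt hK0.le
  have e : l / 2 * K + 1 / l * 2 = 2 * √K := by
    rw [hl]; field_simp; nlinarith
  linarith

/-! ### Overlap of the transition laws from two nearby points -/

namespace StepSize

variable {d : ℕ} {U : E d → ℝ} {T h : ℝ} {N : ℕ}

lemma norm_fderiv_verletPosition_sub_smul_le (hs : StepSize U T h N) (hU : Potential U)
    (x v : E d) :
    ‖fderiv ℝ (verletPosition U h N x) v - T • ContinuousLinearMap.id ℝ (E d)‖ ≤ 1 / 11 * T := by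
  have := (leapfrog_fderiv h hU x v).norm_sub_le_of_growth hs.h_pos.le hs.T_pos hs.N_mul hU.L_nonneg
    (hs.L_mul_sq_le hU) (D := T) (fun k _ =>
      (ContinuousLinearMap.opNorm_comp_le _ _).trans
        (by gcongr; exact hU.norm_fderiv_gradient_le _))
    (by simpa [fderiv_verletPosition_zero] using hs.T_pos.le)
    (by
      rw [fderiv_verletPosition_zero, fderiv_verletVelocity_zero, zero_add, norm_smul,
        Real.norm_of_nonneg hs.T_pos.le]
      exact mul_le_of_le_one_right hs.T_pos.le ContinuousLinearMap.norm_id_le)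
  simpa [fderiv_verletPosition_zero, fderiv_verletVelocity_zero] using this

lemma exists_equiv_fderiv_verletPosition (hs : StepSize U T h N) (hU : Potential U) (x v : E d) :
    ∃ e : E d ≃L[ℝ] E d, (e : E d →L[ℝ] E d) = fderiv ℝ (verletPosition U h N x) v ∧
      ‖(e.symm : E d →L[ℝ] E d)‖ ≤ 11 / (10 * T) := by
  have hT := hs.T_pos
  set J := fderiv ℝ (verletPosition U h N x) v with hJ
  -- `J` differs from `T • id` by at most `T / 11`, so it is bounded below. In finite dimension this
  -- gives invertibility, with the stated bound on the inverse.
  have hlow (u : E d) : 10 / 11 * T * ‖u‖ ≤ ‖J u‖ := by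
    have h1 := (J - T • ContinuousLinearMap.id ℝ (E d)).le_of_opNorm_le
      (hs.norm_fderiv_verletPosition_sub_smul_le hU x v) u
    have h2 : T • u = J u - (J - T • ContinuousLinearMap.id ℝ (E d)) u := by simp
    have h3 : ‖T • u‖ = T * ‖u‖ := by rw [norm_smul, Real.norm_of_nonneg hT.le]
    have h4 := norm_sub_le (J u) ((J - T • ContinuousLinearMap.id ℝ (E d)) u)
    rw [← h2, h3] at h4
    linarith
  have hinj : Function.Injective J.toLinearMap := by
    rw [injective_iff_map_eq_zero]
    intro u hu
    have := hlow u
    have hu' : J u = 0 := hu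
    rw [hu', norm_zero] at this
    have : ‖u‖ ≤ 0 := by
      by_contra hc
      have : 0 < 10 / 11 * T * ‖u‖ := by push Not at hc; positivity
      linarith
    simpa using this
  set e := (LinearEquiv.ofInjectiveEndo J.toLinearMap hinj).toContinuousLinearEquiv with he
  have heJ (u : E d) : e u = J u := rfl
  refine ⟨e, ContinuousLinearMap.ext heJ, ?_⟩
  refine ContinuousLinearMap.opNorm_le_bound _ (by positivity) fun w => ?_
  have := hlow (e.symm w)
  rw [← heJ, e.apply_symm_apply] at this
  change ‖e.symm w‖ ≤ _
  rw [div_mul_eq_mul_div, le_div_iff₀ (by positivity)]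
  linarith

/-- After division by `T`, the map is a `1/11`-Lipschitz perturbation of the identity. -/
lemma bijective_verletPosition (hs : StepSize U T h N) (hU : Potential U) (x : E d) :
    Function.Bijective (verletPosition U h N x) := by
  have hT := hs.T_pos
  have key (v w : E d) : ‖verletPosition U h N x v - verletPosition U h N x w - T • (v - w)‖ ≤
      1 / 11 * (T * ‖v - w‖) := by
    have := hs.norm_verletPosition_sub_sub_le hU x v x w (D := T * ‖v - w‖)
      (by simp; positivity) (by rw [sub_self, zero_add, norm_smul, Real.norm_of_nonneg hT.le])
    simpa using this
  have hA : ApproximatesLinearOn (fun v => T⁻¹ • verletPosition U h N x v)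
      ((ContinuousLinearEquiv.refl ℝ (E d) : E d ≃L[ℝ] E d) : E d →L[ℝ] E d) Set.univ
      (1 / 11 : NNReal) := by
    intro v _ w _
    have e : T⁻¹ • verletPosition U h N x v - T⁻¹ • verletPosition U h N x w -
        ((ContinuousLinearEquiv.refl ℝ (E d) : E d ≃L[ℝ] E d) : E d →L[ℝ] E d) (v - w) =
        T⁻¹ • (verletPosition U h N x v - verletPosition U h N x w - T • (v - w)) := by
      rw [smul_sub, smul_sub, smul_smul, inv_mul_cancel₀ hT.ne']; simp
    rw [e, norm_smul, Real.norm_of_nonneg (by positivity)]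
    calc T⁻¹ * _ ≤ T⁻¹ * (1 / 11 * (T * ‖v - w‖)) := by gcongr; exact key v w
      _ = _ := by push_cast; field_simp
  have hc : Subsingleton (E d) ∨ (1 / 11 : NNReal) <
      ‖((ContinuousLinearEquiv.refl ℝ (E d)).symm : E d →L[ℝ] E d)‖₊⁻¹ := by
    rcases subsingleton_or_nontrivial (E d) with h | h
    · exact Or.inl h
    · right
      have : ‖((ContinuousLinearEquiv.refl ℝ (E d)).symm : E d →L[ℝ] E d)‖₊ = 1 :=
        NNReal.eq ContinuousLinearMap.norm_id
      rw [this, inv_one]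
      rw [div_lt_one (by norm_num)]; norm_num
  have hb : Function.Bijective fun v => T⁻¹ • verletPosition U h N x v :=
    ⟨Set.injOn_univ.1 (hA.injOn hc), hA.surjective hc⟩
  have h2 : verletPosition U h N x =
      (fun w : E d => T • w) ∘ fun v => T⁻¹ • verletPosition U h N x v := by
    funext v; simp [smul_smul, mul_inv_cancel₀ hT.ne']
  rw [h2]
  exact (MulAction.bijective₀ hT.ne').comp hb

/-- Lipschitz continuity of the transition kernel in total variation. -/
lemma abs_stdGaussian_preimage_sub_le (hs : StepSize U T h N) (hU : Potential U) (x y : E d)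
    {A : Set (E d)} (hA : MeasurableSet A) :
    |(stdGaussian (E d)).real (verletPosition U h N x ⁻¹' A) -
      (stdGaussian (E d)).real (verletPosition U h N y ⁻¹' A)| ≤
      √((T ^ 2)⁻¹ + 27 * d * LH U ^ 2 * T ^ 4) * ‖x - y‖ := by
  rcases eq_or_ne x y with rfl | hxy
  · simp
  have hT := hs.T_pos
  have hLH := hU.LH_nonneg
  set δ := ‖x - y‖ with hδ
  have hδ0 : 0 < δ := norm_pos_iff.2 (sub_ne_zero.2 hxy)
  have hd1 : (1 : ℝ) ≤ d := by
    have : d ≠ 0 := by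
      rintro rfl
      exact hxy (Subsingleton.elim x y)
    exact_mod_cast Nat.one_le_iff_ne_zero.2 this
  set b := 3 / 4 * LH U * T ^ 2 * δ with hb
  have hb0 : 0 ≤ b := by positivity
  have hsq : √((T ^ 2)⁻¹ + 27 * d * LH U ^ 2 * T ^ 4) * δ =
      √(((T ^ 2)⁻¹ + 27 * d * LH U ^ 2 * T ^ 4) * δ ^ 2) := by
    rw [Real.sqrt_mul (by positivity), Real.sqrt_sq hδ0.le]
  rw [hsq]
  have hbsq : 27 * d * LH U ^ 2 * T ^ 4 * δ ^ 2 = 48 * d * b ^ 2 := by rw [hb]; ring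
  -- The determinant estimate needs `b ≤ 1/2`. Otherwise `48 d b² ≥ 1` already makes the right side
  -- at least `1`.
  rcases lt_or_ge (1 / 2) b with hbig | hb2
  · have h1 : 1 ≤ √(((T ^ 2)⁻¹ + 27 * d * LH U ^ 2 * T ^ 4) * δ ^ 2) := by
      rw [Real.one_le_sqrt, add_mul, hbsq]
      have : 0 ≤ (T ^ 2)⁻¹ * δ ^ 2 := by positivity
      nlinarith
    refine le_trans ?_ h1
    rw [abs_le]
    have u1 := measureReal_nonneg (μ := stdGaussian (E d)) (s := verletPosition U h N x ⁻¹' A)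
    have u2 := measureReal_nonneg (μ := stdGaussian (E d)) (s := verletPosition U h N y ⁻¹' A)
    have u3 := measureReal_le_one (μ := stdGaussian (E d)) (s := verletPosition U h N x ⁻¹' A)
    have u4 := measureReal_le_one (μ := stdGaussian (E d)) (s := verletPosition U h N y ⁻¹' A)
    constructor <;> linarith
  set Φ := Equiv.ofBijective _ (hs.bijective_verletPosition hU y) with hΦ
  set Ψ : E d → E d := fun v => Φ.symm (verletPosition U h N x v) with hΨ
  have hΨeq (v : E d) : verletPosition U h N y (Ψ v) = verletPosition U h N x v :=
    Φ.apply_symm_apply _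
  -- Since the final positions coincide, the deviation from free flight is exactly `-r`, whence `‖r‖
  -- ≤ max δ ‖r‖ / 11`. If the maximum is `‖r‖`, then `r = 0`.
  have hclose (v : E d) : ‖x - y + T • (v - Ψ v)‖ ≤ 1 / 11 * δ := by
    set r := x - y + T • (v - Ψ v) with hr
    have := hs.norm_verletPosition_sub_sub_le hU x v y (Ψ v) (D := max δ ‖r‖)
      (le_max_left _ _) (le_max_right _ _)
    rw [hΨeq, sub_self, zero_sub, ← neg_add', norm_neg] at this
    rcases max_cases δ ‖r‖ with ⟨h1, -⟩ | ⟨h1, -⟩ <;> rw [h1] at this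
    · exact this
    · have := norm_nonneg r
      linarith
  have hclose' (v : E d) : ‖x - y + T • (v - Ψ v)‖ ≤ δ := (hclose v).trans (by linarith)
  choose e he hesymm using fun v => hs.exists_equiv_fderiv_verletPosition hU y (Ψ v)
  have hΨd (v : E d) : HasFDerivAt Ψ (((e v).symm : E d →L[ℝ] E d).comp
      (fderiv ℝ (verletPosition U h N x) v)) v := by
    have hcont : Continuous Φ.symm := by
      have hK : LipschitzWith (Real.toNNReal (11 / (10 * T))) Φ.symm := by
        refine LipschitzWith.of_dist_le_mul fun p q => ?_
        rw [Real.coe_toNNReal _ (by positivity), dist_eq_norm, dist_eq_norm]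
        set v := Φ.symm p
        set w := Φ.symm q
        have hp : verletPosition U h N y v = p := Φ.apply_symm_apply p
        have hq : verletPosition U h N y w = q := Φ.apply_symm_apply q
        have := hs.norm_verletPosition_sub_sub_le hU y v y w (D := T * ‖v - w‖)
          (by simp; positivity)
          (by rw [sub_self, zero_add, norm_smul, Real.norm_of_nonneg hT.le])
        rw [hp, hq, sub_self, sub_zero] at this
        have h2 := norm_sub_norm_le (T • (v - w)) (p - q)
        rw [← norm_neg, neg_sub] at this
        rw [norm_smul, Real.norm_of_nonneg hT.le] at h2
        rw [div_mul_eq_mul_div, le_div_iff₀ (by positivity)]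
        linarith
      exact hK.continuous
    have h1 : HasFDerivAt (verletPosition U h N y) (e v : E d →L[ℝ] E d)
        (Φ.symm (verletPosition U h N x v)) := by
      rw [he]
      exact (differentiable_verletPosition h hU y N _).hasFDerivAt
    have h2 := HasFDerivAt.of_local_left_inverse hcont.continuousAt h1
      (Filter.Eventually.of_forall fun p => Φ.apply_symm_apply p)
    exact h2.comp v (differentiable_verletPosition h hU x N v).hasFDerivAt
  set g : E d → E d := fun v => Ψ v - v with hg
  -- Differentiating the defining relation of `Ψ` gives `DΨ = J_y⁻¹ J_x`, so `Dg = J_y⁻¹ (J_x -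
  -- J_y)` involves only the difference of Jacobians, which is small with `|x - y|`.
  have hgd (v : E d) : HasFDerivAt g (((e v).symm : E d →L[ℝ] E d).comp
      (fderiv ℝ (verletPosition U h N x) v - fderiv ℝ (verletPosition U h N y) (Ψ v))) v := by
    refine ((hΨd v).sub (hasFDerivAt_id v)).congr_fderiv ?_
    rw [ContinuousLinearMap.comp_sub, ← he]
    congr 1
    ext1 u
    simp
  have hga (v : E d) : ‖g v‖ ≤ 12 / 11 * δ / T := by
    have h1 : ‖T • g v‖ = ‖g v‖ * T := by rw [norm_smul, Real.norm_of_nonneg hT.le, mul_comm]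
    have : T • g v = (x - y) - (x - y + T • (v - Ψ v)) := by simp only [hg]; module
    rw [le_div_iff₀ hT, ← h1, this]
    refine (norm_sub_le _ _).trans ?_
    have := hclose v
    linarith
  have hgb (v : E d) : ‖fderiv ℝ g v‖ ≤ b := by
    rw [(hgd v).fderiv]
    refine (ContinuousLinearMap.opNorm_comp_le _ _).trans ?_
    calc _ ≤ 11 / (10 * T) * (1 / 2 * (12 / 11) ^ 3 * LH U * T ^ 3 * δ) := by
          gcongr
          · exact hesymm v
          · exact hs.norm_fderiv_verletPosition_sub_le hU x v y (Ψ v) le_rfl (hclose' v)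
      _ = (11 / 20 * (12 / 11) ^ 3) * (LH U * T ^ 2 * δ) := by field_simp; ring
      _ ≤ 3 / 4 * (LH U * T ^ 2 * δ) := by gcongr; norm_num
      _ = b := by rw [hb]; ring
  have hid : (fun v => v + g v) = Ψ := by funext v; simp [hg]
  have hΨbij : Function.Bijective Ψ :=
    Φ.symm.bijective.comp (hs.bijective_verletPosition hU x)
  have hym : Measurable (verletPosition U h N y) :=
    (differentiable_verletPosition h hU y N).continuous.measurable
  have hmain := abs_stdGaussian_sub_preimage_le (fun v => (hgd v).differentiableAt)
    (by positivity) hga hgb hb2 (by rw [hid]; exact hΨbij) (hym hA)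
  rw [hid, ← Set.preimage_comp] at hmain
  have hcomp : verletPosition U h N y ∘ Ψ = verletPosition U h N x := funext hΨeq
  rw [hcomp] at hmain
  refine hmain.trans (Real.sqrt_le_sqrt ?_)
  rw [add_mul, hbsq]
  have h1 : (12 / 11 * δ / T) ^ 2 / 2 ≤ (T ^ 2)⁻¹ * δ ^ 2 := by
    have : (12 / 11 * δ / T) ^ 2 / 2 = 72 / 121 * ((T ^ 2)⁻¹ * δ ^ 2) := by field_simp; norm_num
    rw [this]
    have : 0 ≤ (T ^ 2)⁻¹ * δ ^ 2 := by positivity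
    linarith
  have h2 : 0 ≤ d * b ^ 2 := by positivity
  linarith

end StepSize

/-! ### Wasserstein distance and Lipschitz test functions -/

section Wasserstein

variable {d : ℕ}

lemma W1_le_lintegral {γ : Measure (E d × E d)} {ν η : Measure (E d)} (hγ : IsCoupling γ ν η) :
    W1 ν η ≤ ∫⁻ p, edist p.1 p.2 ∂γ :=
  iInf₂_le γ hγ

lemma W1_le_swap (ν η : Measure (E d)) : W1 ν η ≤ W1 η ν := by
  refine le_iInf₂ fun γ hγ => ?_
  refine (W1_le_lintegral (γ := γ.map Prod.swap) ⟨?_, ?_⟩).trans ?_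
  · rw [Measure.map_map measurable_fst measurable_swap]; exact hγ.2
  · rw [Measure.map_map measurable_snd measurable_swap]; exact hγ.1
  · rw [lintegral_map (by fun_prop) measurable_swap]
    simp [edist_comm]

lemma W1_comm (ν η : Measure (E d)) : W1 ν η = W1 η ν :=
  (W1_le_swap ν η).antisymm (W1_le_swap η ν)

/-- The easy half of Kantorovich duality, for bounded Lipschitz test functions. -/
lemma ofReal_abs_integral_sub_le {ν η : Measure (E d)} [IsProbabilityMeasure ν] {F : E d → ℝ}
    (hF : Measurable F) {B C : ℝ} (hB : ∀ x, |F x| ≤ B) (hC : 0 < C)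
    (hL : ∀ x y, |F x - F y| ≤ C * ‖x - y‖) :
    ENNReal.ofReal |∫ x, F x ∂ν - ∫ x, F x ∂η| ≤ ENNReal.ofReal C * W1 ν η := by
  have hC' : ENNReal.ofReal C ≠ 0 := by simpa using hC
  rw [mul_comm, ← ENNReal.div_le_iff hC' ENNReal.ofReal_ne_top]
  refine le_iInf₂ fun γ hγ => ?_
  rw [ENNReal.div_le_iff hC' ENNReal.ofReal_ne_top, mul_comm]
  have hp : IsProbabilityMeasure γ := by
    have : IsProbabilityMeasure (γ.map Prod.fst) := by rw [hγ.1]; infer_instance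
    exact Measure.isProbabilityMeasure_of_map Prod.fst
  have hi {G : E d × E d → E d} (hG : Measurable G) : Integrable (fun p => F (G p)) γ :=
    Integrable.of_bound (hF.comp hG).aestronglyMeasurable B (Filter.Eventually.of_forall fun p =>
      hB _)
  have e : ∫ x, F x ∂ν - ∫ x, F x ∂η = ∫ p, (F p.1 - F p.2) ∂γ := by
    rw [integral_sub (hi measurable_fst) (hi measurable_snd)]
    conv_lhs => rw [← hγ.1, ← hγ.2]
    rw [integral_map measurable_fst.aemeasurable hF.aestronglyMeasurable,
      integral_map measurable_snd.aemeasurable hF.aestronglyMeasurable]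
  rw [e, ← lintegral_const_mul _ (by fun_prop)]
  have hdi : Integrable (fun p => |F p.1 - F p.2|) γ :=
    ((hi measurable_fst).sub (hi measurable_snd)).abs
  refine (ENNReal.ofReal_le_ofReal abs_integral_le_integral_abs).trans ?_
  rw [ofReal_integral_eq_lintegral_ofReal hdi (Filter.Eventually.of_forall fun _ => abs_nonneg _)]
  refine lintegral_mono fun p => ?_
  rw [edist_dist, ← ENNReal.ofReal_mul hC.le, dist_eq_norm]
  exact ENNReal.ofReal_le_ofReal (hL _ _)

end Wasserstein

/-! ### The transition kernel -/

section Kernel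

variable {d : ℕ} (U : E d → ℝ) (h : ℝ) (N : ℕ)

lemma kernel_apply (x : E d) :
    kernel U h N x = (stdGaussian (E d)).map (verletPosition U h N x) := rfl

lemma measurable_verletPosition_right (x : E d) : Measurable (verletPosition U h N x) :=
  (measurable_verletPosition U h N).comp measurable_prodMk_left

instance : IsMarkovKernel (kernel U h N) :=
  ⟨fun x => by
    rw [kernel_apply]
    exact Measure.isProbabilityMeasure_map (measurable_verletPosition_right U h N x).aemeasurable⟩

lemma bind_kernel (ν : Measure (E d)) [SFinite ν] :
    ν.bind (kernel U h N) =
      (ν.prod (stdGaussian (E d))).map fun p => verletPosition U h N p.1 p.2 := by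
  ext A hA
  have hm := measurable_verletPosition U h N
  rw [Measure.bind_apply hA (kernel U h N).measurable.aemeasurable, Measure.map_apply hm hA,
    Measure.prod_apply (hm hA)]
  refine lintegral_congr fun x => ?_
  rw [kernel_apply, Measure.map_apply (measurable_verletPosition_right U h N x) hA]
  rfl

lemma measureReal_bind_kernel (ν : Measure (E d)) [IsProbabilityMeasure ν] {A : Set (E d)}
    (hA : MeasurableSet A) :
    (ν.bind (kernel U h N)).real A = ∫ x, (kernel U h N x).real A ∂ν := by
  rw [measureReal_def, Measure.bind_apply hA (kernel U h N).measurable.aemeasurable]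
  simp only [measureReal_def]
  rw [integral_toReal ((kernel U h N).measurable_coe hA).aemeasurable
    (Filter.Eventually.of_forall fun x => measure_lt_top _ _)]

lemma law_zero (ν : Measure (E d)) : law U h N ν 0 = ν := rfl

lemma law_succ (ν : Measure (E d)) (m : ℕ) :
    law U h N ν (m + 1) = (law U h N ν m).bind (kernel U h N) := by
  simp only [law, Function.iterate_succ_apply']

instance isProbabilityMeasure_law (ν : Measure (E d)) [IsProbabilityMeasure ν] (m : ℕ) :
    IsProbabilityMeasure (law U h N ν m) := by
  induction m with
  | zero => rw [law_zero]; infer_instance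
  | succ m ih => rw [law_succ, bind_kernel]
                 exact Measure.isProbabilityMeasure_map (measurable_verletPosition U h N).aemeasurable

end Kernel

namespace StepSize

variable {d : ℕ} {U : E d → ℝ} {T h : ℝ} {N : ℕ}

/-- One uHMC step regularizes the Wasserstein distance into the total variation distance. -/
lemma tv_bind_kernel_le (hs : StepSize U T h N) (hU : Potential U) (ν η : Measure (E d))
    [IsProbabilityMeasure ν] [IsProbabilityMeasure η] {w : ℝ} (hw0 : 0 ≤ w)
    (hw : W1 ν η ≤ ENNReal.ofReal w) :
    tv (ν.bind (kernel U h N)) (η.bind (kernel U h N)) ≤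
      √((T ^ 2)⁻¹ + 27 * d * LH U ^ 2 * T ^ 4) * w := by
  have hT := hs.T_pos
  have hS : 0 < √((T ^ 2)⁻¹ + 27 * d * LH U ^ 2 * T ^ 4) := by positivity
  have : Nonempty {A : Set (E d) // MeasurableSet A} := ⟨⟨∅, MeasurableSet.empty⟩⟩
  refine ciSup_le fun A => ?_
  obtain ⟨A, hA⟩ := A
  have hr (x : E d) : (kernel U h N x).real A =
      (stdGaussian (E d)).real (verletPosition U h N x ⁻¹' A) := by
    rw [kernel_apply, map_measureReal_apply (measurable_verletPosition_right U h N x) hA]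
  -- The test function is the transition probability into `A`, whose Lipschitz constant is the
  -- regularization factor.
  have key := ofReal_abs_integral_sub_le (ν := ν) (η := η)
    (F := fun x => (kernel U h N x).real A)
    ((kernel U h N).measurable_coe hA).ennreal_toReal (B := 1)
    (fun x => by rw [abs_of_nonneg measureReal_nonneg]; exact measureReal_le_one) hS
    (fun x y => by
      rw [hr, hr]; exact hs.abs_stdGaussian_preimage_sub_le hU x y hA)
  rw [← measureReal_bind_kernel U h N ν hA, ← measureReal_bind_kernel U h N η hA] at key
  have := key.trans (mul_le_mul_right hw _)
  rw [← ENNReal.ofReal_mul hS.le] at this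
  exact (ENNReal.ofReal_le_ofReal_iff (by positivity)).1 this

end StepSize

/-! ### A lower bound for the contraction constant -/

lemma W1_map_add_right_le {d : ℕ} (μ : Measure (E d)) [IsProbabilityMeasure μ] {e : E d}
    (he : ‖e‖ ≤ 1) : W1 (μ.map fun y => y + e) μ ≤ 1 := by
  have hm : Measurable fun y : E d => (y + e, y) := by fun_prop
  refine (W1_le_lintegral (γ := μ.map fun y => (y + e, y)) ⟨?_, ?_⟩).trans ?_
  · rw [Measure.map_map measurable_fst hm]; rfl
  · rw [Measure.map_map measurable_snd hm]; exact Measure.map_id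
  · rw [lintegral_map (by fun_prop) hm]
    have (y : E d) : edist (y + e) y ≤ 1 := by
      rw [edist_dist, dist_eq_norm, add_sub_cancel_left]
      exact ENNReal.ofReal_le_one.2 he
    calc _ ≤ ∫⁻ _, 1 ∂μ := lintegral_mono this
      _ = 1 := by simp

/-- Truncation of a real number to `[-n, n]`. -/
def clip (n : ℕ) (t : ℝ) : ℝ := max (min t n) (-n)

lemma abs_clip_le (n : ℕ) (t : ℝ) : |clip n t| ≤ n := by
  rw [abs_le]
  have : (0 : ℝ) ≤ n := n.cast_nonneg
  exact ⟨le_max_right _ _, max_le (min_le_right _ _) (by linarith)⟩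

lemma abs_clip_sub_le (n : ℕ) (s t : ℝ) : |clip n s - clip n t| ≤ |s - t| := by
  refine (abs_max_sub_max_le_abs _ _ _).trans ((abs_min_sub_min_le_max _ _ _ _).trans ?_)
  simp

lemma continuous_clip (n : ℕ) : Continuous (clip n) := by unfold clip; fun_prop

lemma tendsto_clip (t : ℝ) : Filter.Tendsto (fun n => clip n t) Filter.atTop (nhds t) := by
  refine tendsto_const_nhds.congr' ?_
  filter_upwards [Filter.eventually_ge_atTop ⌈|t|⌉₊] with n hn
  have h1 : |t| ≤ n := Nat.ceil_le.1 hn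
  obtain ⟨h2, h3⟩ := abs_le.1 h1
  rw [clip, min_eq_left h3, max_eq_left h2]

namespace W1Convergence

variable {d : ℕ} {U : E d → ℝ} {T h : ℝ} {N : ℕ} {μt : Measure (E d)} {M₁ c : ℝ}

/-- In positive dimension, the rate in one step cannot be much better than the distortion of
distances by the Verlet flow. -/
lemma le_M₁ (hW : W1Convergence U h N μt M₁ c) (hU : Potential U) (hs : StepSize U T h N)
    (hd : 1 ≤ d) : 10 / 11 ≤ M₁ := by
  have := hW.prob
  have hM := hW.M₁_pos
  have hT := hs.T_pos
  obtain ⟨e, he⟩ : ∃ e : E d, ‖e‖ = 1 := ⟨EuclideanSpace.basisFun (Fin d) ℝ ⟨0, hd⟩,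
    (EuclideanSpace.basisFun (Fin d) ℝ).orthonormal.1 _⟩
  have hme : Measurable fun y : E d => y + e := by fun_prop
  -- Translate the invariant law by a unit vector and run both chains with the same velocity. The
  -- positions then still differ by `e` up to `1/11`, while the initial Wasserstein distance is at
  -- most `1`.
  set ν := μt.map fun y => y + e with hν
  have hνp : IsProbabilityMeasure ν := Measure.isProbabilityMeasure_map hme.aemeasurable
  set γ := stdGaussian (E d)
  set P := μt.prod γ
  have hm := measurable_verletPosition U h N
  set X : E d × E d → E d := fun p => verletPosition U h N p.1 p.2 with hX
  set Y : E d × E d → E d := fun p => verletPosition U h N (p.1 + e) p.2 with hY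
  have hYm : Measurable Y := hm.comp (by fun_prop : Measurable fun p : E d × E d => (p.1 + e, p.2))
  have hlaw : law U h N ν 1 = P.map Y := by
    rw [law_succ, law_zero, bind_kernel, hν]
    have h1 := Measure.map_prod_map μt γ hme measurable_id
    rw [Measure.map_id] at h1
    rw [h1, Measure.map_map hm (hme.prodMap measurable_id)]
    rfl
  have hμ : μt = P.map X := by
    conv_lhs => rw [← hW.invariant.def]
    exact bind_kernel U h N μt
  have hclose (p : E d × E d) : ‖Y p - X p - e‖ ≤ 1 / 11 := by
    have := hs.norm_verletPosition_sub_sub_le hU (p.1 + e) p.2 p.1 p.2 (D := 1)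
      (by simp [he]) (by simp [he])
    simpa using this
  have hnorm (p : E d × E d) : ‖Y p - X p‖ ≤ 12 / 11 := by
    have e1 : Y p - X p = (Y p - X p - e) + e := by abel
    rw [e1]
    refine (norm_add_le _ _).trans ?_
    have := hclose p
    rw [he]; linarith
  set F : ℕ → E d → ℝ := fun n x => clip n (inner ℝ e x) with hF
  have hFm (n : ℕ) : Measurable (F n) :=
    ((continuous_clip n).comp (by fun_prop)).measurable
  have hFL (n : ℕ) (x y : E d) : |F n x - F n y| ≤ 1 * ‖x - y‖ := by
    refine (abs_clip_sub_le _ _ _).trans ?_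
    rw [← inner_sub_right, ← he]
    exact abs_real_inner_le_norm _ _
  have hbound (n : ℕ) : ∫ p, (F n (Y p) - F n (X p)) ∂P ≤ M₁ := by
    have h1 := ofReal_abs_integral_sub_le (ν := law U h N ν 1) (η := μt) (hFm n)
      (fun x => abs_clip_le n _) one_pos (hFL n)
    have h2 := hW.conv 1 le_rfl ν hνp
    rw [ENNReal.ofReal_one, one_mul] at h1
    have h3 := (h1.trans h2).trans (mul_le_mul_right (W1_map_add_right_le μt he.le) _)
    rw [mul_one, ENNReal.ofReal_le_ofReal_iff (by positivity)] at h3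
    have hi {Z : E d × E d → E d} (hZ : Measurable Z) : Integrable (fun p => F n (Z p)) P :=
      Integrable.of_bound ((hFm n).comp hZ).aestronglyMeasurable n
        (Filter.Eventually.of_forall fun p => abs_clip_le n _)
    have h4 : ∫ x, F n x ∂(law U h N ν 1) - ∫ x, F n x ∂μt =
        ∫ p, (F n (Y p) - F n (X p)) ∂P := by
      rw [integral_sub (hi hYm) (hi hm), hlaw]
      conv_lhs => rw [hμ]
      rw [integral_map hYm.aemeasurable (hFm n).aestronglyMeasurable,
        integral_map hm.aemeasurable (hFm n).aestronglyMeasurable]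
    rw [h4] at h3
    refine (le_abs_self _).trans (h3.trans ?_)
    refine mul_le_of_le_one_right hM.le (Real.exp_le_one_iff.2 ?_)
    have := hW.c_pos
    simp; linarith
  -- The individual limits need not be integrable, but the differences are dominated by `12/11`.
  have hlim : Filter.Tendsto (fun n => ∫ p, (F n (Y p) - F n (X p)) ∂P) Filter.atTop
      (nhds (∫ p, (inner ℝ e (Y p) - inner ℝ e (X p)) ∂P)) := by
    refine tendsto_integral_of_dominated_convergence (fun _ => 12 / 11) (fun n => ?_)
      (integrable_const _) (fun n => Filter.Eventually.of_forall fun p => ?_)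
      (Filter.Eventually.of_forall fun p => (tendsto_clip _).sub (tendsto_clip _))
    · exact (((hFm n).comp hYm).sub ((hFm n).comp hm)).aestronglyMeasurable
    · exact (hFL n _ _).trans (by rw [one_mul]; exact hnorm p)
  refine le_trans ?_ (le_of_tendsto' hlim hbound)
  have hpt (p : E d × E d) : 10 / 11 ≤ inner ℝ e (Y p) - inner ℝ e (X p) := by
    have e1 : inner ℝ e (Y p) - inner ℝ e (X p) = 1 + inner ℝ e (Y p - X p - e) := by
      rw [inner_sub_right, inner_sub_right, real_inner_self_eq_norm_sq, he]; ring
    have h1 := abs_real_inner_le_norm e (Y p - X p - e)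
    rw [he, one_mul] at h1
    have h2 := (abs_le.1 (h1.trans (hclose p))).1
    rw [e1]; linarith
  have hmeas : Measurable fun p => (inner ℝ e (Y p) - inner ℝ e (X p) : ℝ) := by
    have : Measurable X := hm
    fun_prop
  calc (10 / 11 : ℝ) = ∫ _, (10 / 11 : ℝ) ∂P := by simp
    _ ≤ _ := integral_mono (integrable_const _)
      (Integrable.of_bound hmeas.aestronglyMeasurable (12 / 11)
        (Filter.Eventually.of_forall fun p => by
          rw [← inner_sub_right]
          refine (abs_real_inner_le_norm _ _).trans ?_
          rw [he, one_mul]; exact hnorm p)) hpt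

/-- Any real `Y` dominating the logarithm is allowed. This covers vanishing `W1`, where the
logarithm is `-∞`, as well as the cruder polynomial bounds of part (2). -/
lemma mixingTime_le (hW : W1Convergence U h N μt M₁ c) (hU : Potential U)
    (hs : StepSize U T h N) (ν : Measure (E d)) [IsProbabilityMeasure ν] {ε w Y : ℝ}
    (hw : W1 μt ν ≤ ENNReal.ofReal w) (hw0 : 0 ≤ w)
    (hY : 3 / 2 * √((T ^ 2)⁻¹ + 27 * d * LH U ^ 2 * T ^ 4) * M₁ * w ≤ ε * Real.exp Y) :
    mixingTime U h N μt ε ν ≤ (⌈1 / c * Y⌉₊ + 1 : ℕ) := by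
  have := hW.prob
  have hM := hW.M₁_pos
  have hc := hW.c_pos
  set S := √((T ^ 2)⁻¹ + 27 * d * LH U ^ 2 * T ^ 4) with hS
  have hS0 : 0 ≤ S := Real.sqrt_nonneg _
  have hw' : W1 ν μt ≤ ENNReal.ofReal w := (W1_comm ν μt).trans_le hw
  set m := ⌈1 / c * Y⌉₊ with hm
  refine iInf₂_le (m + 1) ?_
  have hstep {w' : ℝ} (h0 : 0 ≤ w') (h1 : W1 (law U h N ν m) μt ≤ ENNReal.ofReal w') :
      tv μt (law U h N ν (m + 1)) ≤ S * w' := by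
    have := hs.tv_bind_kernel_le hU μt (law U h N ν m) h0 ((W1_comm _ _).trans_le h1)
    rwa [hW.invariant.def, ← law_succ] at this
  have hYm : Y ≤ c * m := by
    have := Nat.le_ceil (1 / c * Y)
    rw [← hm, one_div, ← div_eq_inv_mul, div_le_iff₀ hc] at this
    linarith
  have hexp : 3 / 2 * S * M₁ * w * Real.exp (-c * m) ≤ ε := by
    have h1 : 0 < Real.exp (-c * m) := Real.exp_pos _
    have hε : 0 ≤ ε := by
      have : 0 ≤ ε * Real.exp Y := le_trans (by positivity) hY
      exact nonneg_of_mul_nonneg_left this (Real.exp_pos _)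
    calc _ ≤ ε * Real.exp Y * Real.exp (-c * m) := by gcongr
      _ = ε * Real.exp (Y - c * m) := by rw [mul_assoc, ← Real.exp_add]; congr 2; ring
      _ ≤ ε * 1 := by
        gcongr
        exact Real.exp_le_one_iff.2 (by linarith)
      _ = ε := mul_one ε
  -- At `m = 0` no contraction is available. For `d ≥ 1`, `M₁ ≥ 10/11 > 2/3` turns `(3/2) S M₁ w ≤
  -- ε` into `S w ≤ ε`. For `d = 0` the space is a point and `W1` vanishes.
  rcases Nat.eq_zero_or_pos m with h0 | hpos
  · rcases Nat.eq_zero_or_pos d with hd | hd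
    · subst hd
      have hz : W1 (law U h N ν m) μt ≤ ENNReal.ofReal 0 := by
        refine (W1_le_lintegral (γ := (law U h N ν m).prod μt) ⟨by simp, by simp⟩).trans ?_
        have (p : E 0 × E 0) : edist p.1 p.2 = 0 := by
          rw [Subsingleton.elim p.1 p.2, edist_self]
        simp [this]
      refine (hstep le_rfl hz).trans ?_
      rw [mul_zero]
      exact le_trans (by positivity) hexp
    · have h1 : W1 (law U h N ν m) μt ≤ ENNReal.ofReal w := by rwa [h0, law_zero]
      refine (hstep hw0 h1).trans ?_
      have h2 := hW.le_M₁ hU hs hd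
      rw [h0] at hexp
      simp only [Nat.cast_zero, mul_zero, Real.exp_zero, mul_one] at hexp
      have h3 : 0 ≤ S * w := by positivity
      nlinarith
  · have h1 : W1 (law U h N ν m) μt ≤ ENNReal.ofReal (M₁ * Real.exp (-c * m) * w) := by
      rw [ENNReal.ofReal_mul (by positivity)]
      exact (hW.conv m hpos ν inferInstance).trans (mul_le_mul_right hw' _)
    refine (hstep (by positivity) h1).trans (le_trans ?_ hexp)
    have : 0 ≤ S * M₁ * w * Real.exp (-c * m) := by positivity
    linarith

end W1Convergence

/-! ### The mixing time bounds -/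

section Mixing

variable {d : ℕ} {U : E d → ℝ} {T h : ℝ} {N : ℕ} {μt : Measure (E d)} {M₁ c : ℝ}

lemma coe_le_of_le_natCast {t : ℕ∞} {n : ℕ} (h : t ≤ n) {a : EReal} (ha : ((n : ℝ) : EReal) ≤ a) :
    ((t : ENNReal) : EReal) ≤ a := by
  have h1 : (t : ENNReal) ≤ (n : ENNReal) := by exact_mod_cast h
  refine le_trans (EReal.coe_ennreal_le_coe_ennreal_iff.2 h1) (le_trans (le_of_eq ?_) ha)
  simp
  rfl

/-- The `2` in the final bound consists of the rounding up and the extra regularizing step; the `1`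
is that step alone. -/
lemma natCeil_add_one_le (x : ℝ) : ((⌈x⌉₊ + 1 : ℕ) : ℝ) ≤ max 1 (2 + x) := by
  rcases le_or_gt x 0 with h | h
  · rw [Nat.ceil_eq_zero.2 h]; simp
  · refine le_max_of_le_right ?_
    have := Nat.ceil_lt_add_one h.le
    push_cast; linarith

theorem mixingTime_le_max (hU : Potential U) (hs : StepSize U T h N)
    (hW : W1Convergence U h N μt M₁ c) {ε : ℝ} (hε : 0 < ε) (ν : Measure (E d))
    [IsProbabilityMeasure ν] :
    (((mixingTime U h N μt ε ν : ℕ∞) : ENNReal) : EReal) ≤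
      max 1 (2 + ((1 / c : ℝ) : EReal) *
        ENNReal.log (ENNReal.ofReal
          (3 * √((T ^ 2)⁻¹ + 27 * d * LH U ^ 2 * T ^ 4) * M₁ / (2 * ε)) * W1 μt ν)) := by
  have hM := hW.M₁_pos
  have hc := hW.c_pos
  have hT := hs.T_pos
  have hLH := hU.LH_nonneg
  have hS : 0 < √((T ^ 2)⁻¹ + 27 * d * LH U ^ 2 * T ^ 4) := by positivity
  have hb := fun {w Y : ℝ} => hW.mixingTime_le hU hs ν (ε := ε) (w := w) (Y := Y)
  generalize √((T ^ 2)⁻¹ + 27 * d * LH U ^ 2 * T ^ 4) = S at *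
  have hR : 0 < 3 * S * M₁ / (2 * ε) := by positivity
  rcases eq_or_ne (W1 μt ν) ⊤ with htop | htop
  · rw [htop, ENNReal.mul_top (by simpa using hR), ENNReal.log_top,
      EReal.coe_mul_top_of_pos (by positivity)]
    have : (2 : EReal) + ⊤ = ⊤ := rfl
    rw [this, max_eq_right le_top]
    exact le_top
  obtain ⟨w, hw0, hw⟩ : ∃ w : ℝ, 0 ≤ w ∧ W1 μt ν = ENNReal.ofReal w :=
    ⟨_, ENNReal.toReal_nonneg, (ENNReal.ofReal_toReal htop).symm⟩
  rcases hw0.eq_or_lt with rfl | hwpos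
  · refine coe_le_of_le_natCast (hb (Y := 0) hw.le le_rfl (by simpa using hε.le)) ?_
    refine le_max_of_le_left ?_
    simp
  · rw [hw, ← ENNReal.ofReal_mul hR.le]
    have hpos : 0 < 3 * S * M₁ / (2 * ε) * w := by positivity
    rw [ENNReal.log_ofReal_of_pos hpos]
    refine coe_le_of_le_natCast (hb (Y := Real.log (3 * S * M₁ / (2 * ε) * w)) hw.le hw0 ?_) ?_
    · rw [Real.exp_log hpos]
      exact le_of_eq (by field_simp)
    · have e : ∀ x : ℝ, ((max 1 (2 + x) : ℝ) : EReal) = max 1 (2 + (x : EReal)) := fun x => by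
        rw [EReal.coe_strictMono.monotone.map_max]; rfl
      rw [← EReal.coe_mul, ← e, EReal.coe_le_coe_iff]
      exact natCeil_add_one_le _

theorem exists_mixingTime_le_log (T c A : ℝ) (p : ℕ) : ∃ C : ℝ,
    ∀ (d : ℕ) (U : E d → ℝ) (h : ℝ) (N : ℕ) (μt : Measure (E d)) (M₁ : ℝ),
      1 ≤ d → Potential U → StepSize U T h N → W1Convergence U h N μt M₁ c →
      LH U ≤ A * d ^ p → M₁ ≤ A * d ^ p →
      ∀ (ν : Measure (E d)), IsProbabilityMeasure ν →
        W1 μt ν ≤ ENNReal.ofReal (A * d ^ p) →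
        ∀ (ε : ℝ), 0 < ε → ε < 1 →
          (((mixingTime U h N μt ε ν : ℕ∞) : ENNReal) : EReal) ≤
            ((C * (1 + Real.log d + Real.log (1 / ε)) : ℝ) : EReal) := by
  set Q := 3 / 2 * (T⁻¹ + 6 * A * T ^ 2) * A * A with hQ
  -- `C` is chosen before any sign of `T`, `c` or `A` is known, hence the absolute value; adding `1`
  -- makes `κ ≥ 0`.
  set κ := Real.log (|Q| + 1) with hκ
  refine ⟨2 + 1 / c * (κ + (3 * p + 1)), ?_⟩
  intro d U h N μt M₁ hd hU hs hW hLH hMA ν hν hw ε hε hε1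
  have hM := hW.M₁_pos
  have hc := hW.c_pos
  have hT := hs.T_pos
  have hLH0 := hU.LH_nonneg
  have hd1 : (1 : ℝ) ≤ d := by exact_mod_cast hd
  have hd0 : (0 : ℝ) < d := by linarith
  have hA : 0 < A := by
    have : 0 < A * (d : ℝ) ^ p := hM.trans_le hMA
    exact pos_of_mul_pos_left this (by positivity)
  have hQ0 : 0 < Q := by positivity
  rw [abs_of_pos hQ0] at hκ
  have hκ0 : 0 ≤ κ := by rw [hκ]; exact Real.log_nonneg (by linarith)
  have hld : 0 ≤ Real.log d := Real.log_nonneg hd1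
  have hle : 0 ≤ Real.log (1 / ε) := Real.log_nonneg (by rw [le_div_iff₀ hε]; linarith)
  -- The exponent `3 p + 1` collects `d ^ (p + 1)` from the regularization factor and `d ^ p` each
  -- from `M₁` and `W1`.
  set Y := κ + (3 * p + 1) * Real.log d + Real.log (1 / ε) with hY
  have hY0 : 0 ≤ Y := by positivity
  have hexpY : Real.exp Y = (Q + 1) * (d : ℝ) ^ (3 * p + 1) * (1 / ε) := by
    rw [hY, Real.exp_add, Real.exp_add, hκ, Real.exp_log (by positivity),
      Real.exp_log (by positivity)]
    congr 2
    rw [← Real.exp_log (pow_pos hd0 (3 * p + 1)), Real.log_pow]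
    push_cast; rfl
  have hS : √((T ^ 2)⁻¹ + 27 * d * LH U ^ 2 * T ^ 4) ≤
      (T⁻¹ + 6 * A * T ^ 2) * (d : ℝ) ^ (p + 1) := by
    refine Real.sqrt_le_iff.2 ⟨by positivity, ?_⟩
    have hp1 : (1 : ℝ) ≤ (d : ℝ) ^ (p + 1) := one_le_pow₀ hd1
    have h1 : (T ^ 2)⁻¹ ≤ (T⁻¹ * (d : ℝ) ^ (p + 1)) ^ 2 := by
      rw [mul_pow, inv_pow]
      exact le_mul_of_one_le_right (by positivity) (one_le_pow₀ hp1)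
    -- Uses `27 ≤ 6²` and `d ≤ d²`.
    have h2 : 27 * d * LH U ^ 2 * T ^ 4 ≤ (6 * A * T ^ 2 * (d : ℝ) ^ (p + 1)) ^ 2 := by
      calc 27 * d * LH U ^ 2 * T ^ 4 ≤ 36 * (d * d) * (A * d ^ p) ^ 2 * T ^ 4 := by
            gcongr
            · norm_num
            · exact le_mul_of_one_le_right hd0.le hd1
        _ = _ := by ring
    have h3 : 0 ≤ T⁻¹ * (d : ℝ) ^ (p + 1) * (6 * A * T ^ 2 * (d : ℝ) ^ (p + 1)) := by positivity
    nlinarith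
  have hbound : 3 / 2 * √((T ^ 2)⁻¹ + 27 * d * LH U ^ 2 * T ^ 4) * M₁ * (A * d ^ p) ≤
      ε * Real.exp Y := by
    rw [hexpY]
    calc _ ≤ 3 / 2 * ((T⁻¹ + 6 * A * T ^ 2) * (d : ℝ) ^ (p + 1)) * (A * d ^ p) *
          (A * d ^ p) := by gcongr
      _ = Q * (d : ℝ) ^ (3 * p + 1) := by rw [hQ]; ring
      _ ≤ (Q + 1) * (d : ℝ) ^ (3 * p + 1) := by gcongr; linarith
      _ = _ := by field_simp
  refine coe_le_of_le_natCast (hW.mixingTime_le hU hs ν hw (by positivity) hbound) ?_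
  rw [EReal.coe_le_coe_iff]
  have hcY : 0 ≤ 1 / c * Y := by positivity
  refine (natCeil_add_one_le _).trans (max_le ?_ ?_)
  · have : 0 ≤ 1 / c * (κ + (3 * p + 1)) := by positivity
    nlinarith
  · have h1 : Y ≤ (κ + (3 * p + 1)) * (1 + Real.log d + Real.log (1 / ε)) := by
      have hp0 : (0 : ℝ) ≤ p := p.cast_nonneg
      have a1 := mul_nonneg hκ0 hld
      have a2 := mul_nonneg hκ0 hle
      have a3 := mul_nonneg hp0 hle
      rw [hY]; nlinarith
    have h2 : 1 / c * Y ≤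
        1 / c * ((κ + (3 * p + 1)) * (1 + Real.log d + Real.log (1 / ε))) := by gcongr
    linarith

end Mixing

end UHMC

end

theorem mainTheorem4 :
    (∀ (d : ℕ) (U : UHMC.E d → ℝ) (T h : ℝ) (N : ℕ)
      (μt : MeasureTheory.Measure (UHMC.E d)) (M₁ c : ℝ),
      UHMC.Potential U → UHMC.StepSize U T h N → UHMC.W1Convergence U h N μt M₁ c →
      ∀ (ε : ℝ), 0 < ε → ∀ (ν : MeasureTheory.Measure (UHMC.E d)),
        MeasureTheory.IsProbabilityMeasure ν →
        (((UHMC.mixingTime U h N μt ε ν : ℕ∞) : ENNReal) : EReal) ≤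
          max 1 (2 + ((1 / c : ℝ) : EReal) *
            ENNReal.log (ENNReal.ofReal
                (3 * Real.sqrt ((T ^ 2)⁻¹ + 27 * d * UHMC.LH U ^ 2 * T ^ 4) * M₁ / (2 * ε)) *
              UHMC.W1 μt ν))) ∧
    (∀ (T c A : ℝ) (p : ℕ), ∃ C : ℝ,
      ∀ (d : ℕ) (U : UHMC.E d → ℝ) (h : ℝ) (N : ℕ)
        (μt : MeasureTheory.Measure (UHMC.E d)) (M₁ : ℝ),
        1 ≤ d →
        UHMC.Potential U → UHMC.StepSize U T h N → UHMC.W1Convergence U h N μt M₁ c →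
        UHMC.LH U ≤ A * d ^ p → M₁ ≤ A * d ^ p →
        ∀ (ν : MeasureTheory.Measure (UHMC.E d)), MeasureTheory.IsProbabilityMeasure ν →
          UHMC.W1 μt ν ≤ ENNReal.ofReal (A * d ^ p) →
          ∀ (ε : ℝ), 0 < ε → ε < 1 →
            (((UHMC.mixingTime U h N μt ε ν : ℕ∞) : ENNReal) : EReal) ≤
              ((C * (1 + Real.log d + Real.log (1 / ε)) : ℝ) : EReal)) := by
  refine ⟨fun d U T h N μt M₁ c hU hs hW ε hε ν hν => UHMC.mixingTime_le_max hU hs hW hε ν,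
    UHMC.exists_mixingTime_le_log⟩
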